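/- **Theorem (orbital stability of standing waves).** Let $N\ge 1$, $m\ge 0$, $M>0$, $0<s<N/2$ and $0<\gamma<2s$. Let $V\in C^\infty(\mathbb R^N;\mathbb R)$ satisfy $V(x)\ge c_1$ for all $x$, for some constant $c_1>0$, and $V(x)\to\infty$ as $|x|\to\infty$. Let $(-\Delta+m^2)^{\sigma}$ be the Fourier multiplier with symbol $(|\xi|^2+m^2)^\sigma$, where $-\Delta$ has symbol $|\xi|^2$. Let $$\Sigma^s=\{v\in L^2(\mathbb R^N;\mathbb C):\ (-\Delta+m^2)^{s/2}v\in L^2,\ \sqrt V\,v\in L^2\},\qquad \|v\|_{\Sigma^s}^2=\|(-\Delta+m^2)^{s/2}v\|_{2}^2+\int V|v|^2\,dx ,$$ and let $\Sigma^{-s}$ be the dual of the Hilbert space $\Sigma^s$, with $\Sigma^s\subset L^2\subset\Sigma^{-s}$ through the $L^2$ scalar product. For $v\in\Sigma^s$ put $$M(v)=\int|v|^2\,dx,\qquad E(v)=\tfrac12\|v\|_{\Sigma^s}^2-\tfrac14\iint\frac{|v(x)|^2|v(y)|^2}{|x-y|^\gamma}\,dx\,dy ,$$ and let $S_M$ be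 the set of ground states of mass $M$, that is, the set of all minimizers of $E$ on $\{v\in\Sigma^s: M(v)=M\}$. Consider the Cauchy problem $$iu_t=(-\Delta+m^2)^su+Vu-\Big(\frac1{|x|^\gamma}*|u|^2\Big)u,\qquad u(0)=u_0\in\Sigma^s, \tag{1}$$ whose solutions are the functions $u\in C(\mathbb R;\Sigma^s)\cap C^1(\mathbb R;\Sigma^{-s})$ that satisfy the equation in $\Sigma^{-s}$ for every $t\in\mathbb R$ and the initial condition. Assume that (1) is globally well-posed with conservation laws: for every $u_0\in\Sigma^s$ there is exactly one solution $u$, and $M(u(t))=M(u_0)$ and $E(u(t))=E(u_0)$ for all $t\in\mathbb R$. Then $S_M$ is orbitally stable: for every $\varepsilon>0$ there is $\delta>0$ such that, whenever $u_0\in\Sigma^s$ satisfies $$\inf_{v\in S_M}\|u_0-v\|_{\Sigma^s}<\delta ,$$ the solution $u$ of (1) satisfies $$\inf_{v\in S_M}\|u(t)-v\|_{\Sigma^s}<\varepsilon\qquad\text{for all } t\in\mathbb R .$$ -/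

import Mathlib

open MeasureTheory FourierTransform
open scoped ENNReal ContDiff InnerProductSpace ComplexConjugate

noncomputable section

namespace FracHartree

/-- `ℝ^N` with its Euclidean norm. -/
abbrev Space (N : ℕ) : Type := EuclideanSpace ℝ (Fin N)

/-- The Hilbert space `L²(ℝ^N; ℂ)`. -/
abbrev L2 (N : ℕ) : Type := Lp ℂ 2 (volume : Measure (Space N))

/-- The potentials considered: smooth, bounded below by a positive constant, and tending to `+∞`
at infinity. -/
structure IsConfining {N : ℕ} (V : Space N → ℝ) : Prop where
  smooth : ContDiff ℝ ∞ V
  lower_bound : ∃ c₁ : ℝ, 0 < c₁ ∧ ∀ x, c₁ ≤ V x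
  tendsto_atTop : Filter.Tendsto V (Filter.cocompact (Space N)) Filter.atTop

/-- The Fourier symbol of `(-Δ + m²)^σ`.  Mathlib's Fourier transform is
`𝓕 f ξ = ∫ exp (-2πi ⟪x, ξ⟫) f x`, so that `-Δ` has the symbol `(2π‖ξ‖)²`. -/
def symbol {N : ℕ} (m σ : ℝ) (ξ : Space N) : ℝ :=
  ((2 * Real.pi * ‖ξ‖) ^ 2 + m ^ 2) ^ σ

/-- `(-Δ + m²)^σ v ∈ L²`, for `v ∈ L²`. -/
def MemFracDomain {N : ℕ} (m σ : ℝ) (v : L2 N) : Prop :=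
  MemLp (fun ξ => (symbol m σ ξ : ℂ) * (𝓕 v : L2 N) ξ) 2 volume

/-- `(-Δ + m²)^σ v = 𝓕⁻¹ [((2π‖ξ‖)² + m²)^σ 𝓕 v]`. -/
def fracOp {N : ℕ} (m σ : ℝ) (v : L2 N) (hv : MemFracDomain m σ v) : L2 N :=
  𝓕⁻ (hv.toLp _ : L2 N)

/-- `√V v ∈ L²`, for `v ∈ L²`. -/
def MemPotDomain {N : ℕ} (V : Space N → ℝ) (v : L2 N) : Prop :=
  MemLp (fun x => (√(V x) : ℂ) * v x) 2 volume

/-- `√V v` as an element of `L²`. -/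
def potOp {N : ℕ} (V : Space N → ℝ) (v : L2 N) (hv : MemPotDomain V v) : L2 N :=
  hv.toLp _

section Linearity

variable {N : ℕ}

theorem memLp_mul_add {g : Space N → ℂ} {u v : L2 N}
    (hu : MemLp (fun x => g x * u x) 2 volume) (hv : MemLp (fun x => g x * v x) 2 volume) :
    MemLp (fun x => g x * (u + v : L2 N) x) 2 volume := by
  refine (hu.add hv).ae_eq ?_
  filter_upwards [Lp.coeFn_add u v] with x hx
  simp only [Pi.add_apply, hx]
  ring

theorem toLp_mul_add {g : Space N → ℂ} {u v : L2 N}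
    (hu : MemLp (fun x => g x * u x) 2 volume) (hv : MemLp (fun x => g x * v x) 2 volume)
    (huv : MemLp (fun x => g x * (u + v : L2 N) x) 2 volume) :
    huv.toLp _ = hu.toLp _ + hv.toLp _ := by
  rw [← MemLp.toLp_add, MemLp.toLp_eq_toLp_iff]
  filter_upwards [Lp.coeFn_add u v] with x hx
  simp only [Pi.add_apply, hx]
  ring

theorem memLp_mul_smul {g : Space N → ℂ} (c : ℂ) {v : L2 N}
    (hv : MemLp (fun x => g x * v x) 2 volume) :
    MemLp (fun x => g x * (c • v : L2 N) x) 2 volume := by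
  refine (hv.const_smul c).ae_eq ?_
  filter_upwards [Lp.coeFn_smul c v] with x hx
  simp only [Pi.smul_apply, hx, smul_eq_mul]
  ring

theorem toLp_mul_smul {g : Space N → ℂ} (c : ℂ) {v : L2 N}
    (hv : MemLp (fun x => g x * v x) 2 volume)
    (hcv : MemLp (fun x => g x * (c • v : L2 N) x) 2 volume) :
    hcv.toLp _ = c • hv.toLp _ := by
  rw [← MemLp.toLp_const_smul, MemLp.toLp_eq_toLp_iff]
  filter_upwards [Lp.coeFn_smul c v] with x hx
  simp only [Pi.smul_apply, hx, smul_eq_mul]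
  ring

theorem memLp_mul_zero {g : Space N → ℂ} :
    MemLp (fun x => g x * (0 : L2 N) x) 2 volume := by
  refine (MemLp.zero (ε := ℂ) (p := 2) (μ := (volume : Measure (Space N)))).ae_eq ?_
  filter_upwards [Lp.coeFn_zero ℂ 2 (volume : Measure (Space N))] with x _
  simp

end Linearity

/-- The set `{v ∈ L² : (-Δ + m²)^{s/2} v ∈ L², √V v ∈ L²}`, as a linear subspace of `L²`. -/
def energySubmodule {N : ℕ} (V : Space N → ℝ) (m s : ℝ) : Submodule ℂ (L2 N) where
  carrier := {v | MemFracDomain m (s / 2) v ∧ MemPotDomain V v}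
  zero_mem' := by
    refine ⟨?_, memLp_mul_zero⟩
    simpa only [MemFracDomain, FourierTransform.fourier_zero] using memLp_mul_zero
  add_mem' := by
    rintro u v ⟨hu, hu'⟩ ⟨hv, hv'⟩
    refine ⟨?_, memLp_mul_add hu' hv'⟩
    simpa only [MemFracDomain, FourierTransform.fourier_add] using memLp_mul_add hu hv
  smul_mem' := by
    rintro c v ⟨hv, hv'⟩
    refine ⟨?_, memLp_mul_smul c hv'⟩
    simpa only [MemFracDomain, FourierTransform.fourier_smul] using memLp_mul_smul c hv

/-- The energy space `Σ^s`.  It is a type of its own, because it does not carry the norm of `L²`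
but the energy norm defined below; `hV` makes that norm definite and stronger than the `L²` norm. -/
def EnergySpace {N : ℕ} {V : Space N → ℝ} (_hV : IsConfining V) (m s : ℝ) : Type :=
  ↥(energySubmodule V m s)

namespace EnergySpace

variable {N : ℕ} {V : Space N → ℝ} {hV : IsConfining V} {m s : ℝ}

instance : AddCommGroup (EnergySpace hV m s) :=
  inferInstanceAs (AddCommGroup ↥(energySubmodule V m s))

instance : Module ℂ (EnergySpace hV m s) :=
  inferInstanceAs (Module ℂ ↥(energySubmodule V m s))

/-- The inclusion `Σ^s ⊆ L²`, as a linear map. -/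
def toL2 : EnergySpace hV m s →ₗ[ℂ] L2 N :=
  (energySubmodule V m s).subtype

theorem toL2_injective : Function.Injective (toL2 (hV := hV) (m := m) (s := s)) :=
  Subtype.val_injective

theorem memFracDomain (v : EnergySpace hV m s) : MemFracDomain m (s / 2) (toL2 v) :=
  v.2.1

theorem memPotDomain (v : EnergySpace hV m s) : MemPotDomain V (toL2 v) :=
  v.2.2

/-- `v ↦ (-Δ + m²)^{s/2} v`, from `Σ^s` to `L²`. -/
def kin : EnergySpace hV m s →ₗ[ℂ] L2 N where
  toFun v := fracOp m (s / 2) (toL2 v) v.memFracDomain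
  map_add' u v := by
    unfold fracOp
    rw [← FourierTransform.fourierInv_add]
    congr 1
    simp only [map_add, FourierTransform.fourier_add]
    exact toLp_mul_add u.memFracDomain v.memFracDomain _
  map_smul' c v := by
    unfold fracOp
    rw [RingHom.id_apply, ← FourierTransform.fourierInv_smul]
    congr 1
    simp only [map_smul, FourierTransform.fourier_smul]
    exact toLp_mul_smul c v.memFracDomain _

/-- `v ↦ √V v`, from `Σ^s` to `L²`. -/
def pot : EnergySpace hV m s →ₗ[ℂ] L2 N where
  toFun v := potOp V (toL2 v) v.memPotDomain
  map_add' u v := by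
    unfold potOp
    simp only [map_add]
    exact toLp_mul_add u.memPotDomain v.memPotDomain _
  map_smul' c v := by
    unfold potOp
    simp only [map_smul]
    exact toLp_mul_smul c v.memPotDomain _

theorem bound_norm_toL2 {c : ℝ} (hcV : ∀ x, c ≤ V x) (v : EnergySpace hV m s) :
    √c * ‖toL2 v‖ ≤ ‖pot v‖ := by
  have h : ‖((√c : ℝ) : ℂ) • toL2 v‖ ≤ ‖pot v‖ := by
    apply Lp.norm_le_norm_of_ae_le
    filter_upwards [Lp.coeFn_smul ((√c : ℝ) : ℂ) (toL2 v), v.memPotDomain.coeFn_toLp]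
      with x hx hx'
    have hx'' : pot v x = (√(V x) : ℂ) * toL2 v x := hx'
    rw [hx, hx'', Pi.smul_apply, smul_eq_mul, norm_mul, norm_mul, Complex.norm_real,
      Complex.norm_real, Real.norm_of_nonneg (Real.sqrt_nonneg _),
      Real.norm_of_nonneg (Real.sqrt_nonneg _)]
    gcongr
    exact hcV x
  rwa [norm_smul, Complex.norm_real, Real.norm_of_nonneg (Real.sqrt_nonneg _)] at h

/-- The scalar product of `Σ^s`,
`⟪u, v⟫ = ⟪(-Δ + m²)^{s/2} u, (-Δ + m²)^{s/2} v⟫_{L²} + ⟪√V u, √V v⟫_{L²}`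
(antilinear in `u`). -/
@[reducible] def innerCore : InnerProductSpace.Core ℂ (EnergySpace hV m s) where
  inner u v := ⟪kin u, kin v⟫_ℂ + ⟪pot u, pot v⟫_ℂ
  conj_inner_symm u v := by simp [inner_conj_symm]
  re_inner_nonneg v := by
    rw [map_add]
    exact add_nonneg inner_self_nonneg inner_self_nonneg
  add_left u v w := by simp only [map_add, inner_add_left]; ring
  smul_left u v c := by simp only [map_smul, inner_smul_left]; ring
  definite v hv := by
    obtain ⟨c, hc, hcV⟩ := hV.lower_bound
    have h1 : RCLike.re ⟪kin v, kin v⟫_ℂ + RCLike.re ⟪pot v, pot v⟫_ℂ = 0 := by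
      rw [← map_add, hv, map_zero]
    rw [inner_self_eq_norm_sq, inner_self_eq_norm_sq] at h1
    have h2 : ‖pot v‖ = 0 := by
      have := sq_nonneg ‖kin v‖
      have := sq_nonneg ‖pot v‖
      exact pow_eq_zero_iff (two_ne_zero) |>.1 (by linarith)
    have h3 := bound_norm_toL2 hcV v
    have h4 : ‖toL2 v‖ = 0 := by
      have := norm_nonneg (toL2 v)
      have := Real.sqrt_pos.2 hc
      nlinarith
    exact toL2_injective (by rw [norm_eq_zero.1 h4, map_zero])

/-- The energy norm `‖v‖_{Σ^s} = (‖(-Δ + m²)^{s/2} v‖₂² + ‖√V v‖₂²)^{1/2}`. -/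
instance : NormedAddCommGroup (EnergySpace hV m s) :=
  innerCore.toNormedAddCommGroup

instance : InnerProductSpace ℂ (EnergySpace hV m s) :=
  InnerProductSpace.ofCore innerCore.toCore

theorem inner_def (u v : EnergySpace hV m s) :
    ⟪u, v⟫_ℂ = ⟪kin u, kin v⟫_ℂ + ⟪pot u, pot v⟫_ℂ := rfl

theorem norm_sq_eq (v : EnergySpace hV m s) : ‖v‖ ^ 2 = ‖kin v‖ ^ 2 + ‖pot v‖ ^ 2 := by
  rw [← inner_self_eq_norm_sq (𝕜 := ℂ) v, inner_def, map_add, inner_self_eq_norm_sq,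
    inner_self_eq_norm_sq]

theorem exists_bound_toL2 : ∃ C : ℝ, ∀ v : EnergySpace hV m s, ‖toL2 v‖ ≤ C * ‖v‖ := by
  obtain ⟨c, hc, hcV⟩ := hV.lower_bound
  refine ⟨(√c)⁻¹, fun v => ?_⟩
  have h1 := bound_norm_toL2 hcV v
  have h2 : ‖pot v‖ ≤ ‖v‖ := by
    have := norm_sq_eq v
    have := sq_nonneg ‖kin v‖
    exact abs_le_of_sq_le_sq' (by linarith) (norm_nonneg v) |>.2
  rw [inv_mul_eq_div, le_div_iff₀ (Real.sqrt_pos.2 hc), mul_comm]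
  exact h1.trans h2

/-- The inclusion `Σ^s ⊆ L²`, as a continuous linear map. -/
def toL2L : EnergySpace hV m s →L[ℂ] L2 N :=
  toL2.mkContinuousOfExistsBound exists_bound_toL2

end EnergySpace

open EnergySpace

variable {N : ℕ} {V : Space N → ℝ} {hV : IsConfining V} {m s : ℝ}

/-- The dual space `Σ^{-s}` of `Σ^s`: the continuous antilinear functionals, with the dual norm. -/
abbrev DualSpace {N : ℕ} {V : Space N → ℝ} (hV : IsConfining V) (m s : ℝ) : Type :=
  EnergySpace hV m s →L⋆[ℂ] ℂ

/-- The inclusion `Σ^s ⊆ L² ⊆ Σ^{-s}`, where `u` acts as `φ ↦ ⟪φ, u⟫_{L²} = ∫ conj φ * u`. -/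
def toDual (u : EnergySpace hV m s) : DualSpace hV m s :=
  (innerSLFlip ℂ (toL2L u)).comp toL2L

theorem toDual_apply (u φ : EnergySpace hV m s) : toDual u φ = ⟪toL2 φ, toL2 u⟫_ℂ := rfl

/-- The mass `M(v) = ∫ |v|²`. -/
def mass (v : EnergySpace hV m s) : ℝ :=
  ∫ x, ‖toL2 v x‖ ^ 2

/-- The Hartree potential `|x|^{-γ} * |v|²`. -/
def hartreePotential (γ : ℝ) (v : EnergySpace hV m s) (x : Space N) : ℝ :=
  ∫ y, ‖toL2 v y‖ ^ 2 / ‖x - y‖ ^ γ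

/-- The energy `E(v) = ½ ‖v‖²_{Σ^s} - ¼ ∫ (|x|^{-γ} * |v|²) |v|²`. -/
def energy (γ : ℝ) (v : EnergySpace hV m s) : ℝ :=
  1 / 2 * ‖v‖ ^ 2 - 1 / 4 * ∫ x, hartreePotential γ v x * ‖toL2 v x‖ ^ 2

/-- `u` is a global solution in `C(ℝ; Σ^s) ∩ C¹(ℝ; Σ^{-s})` of
`i u_t = (-Δ + m²)^s u + V u - (|x|^{-γ} * |u|²) u`, `u(0) = u₀`, the equation being understood
in `Σ^{-s}` for every `t`: `(-Δ + m²)^s u + V u` is the functional `φ ↦ ⟪φ, u⟫_{Σ^s}`. -/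
structure IsSolution (γ : ℝ) (u₀ : EnergySpace hV m s) (u : ℝ → EnergySpace hV m s) : Prop where
  continuous : Continuous u
  contDiff : ContDiff ℝ 1 (fun t => toDual (u t))
  initial : u 0 = u₀
  equation : ∀ (t : ℝ) (φ : EnergySpace hV m s),
    Complex.I * deriv (fun τ => toDual (u τ)) t φ =
      ⟪φ, u t⟫_ℂ - ∫ x, (hartreePotential γ (u t) x : ℂ) * toL2 (u t) x * conj (toL2 φ x)

/-- Global well-posedness of the Cauchy problem in `Σ^s`, with conservation of mass and energy. -/
def GloballyWellPosed {N : ℕ} {V : Space N → ℝ} (hV : IsConfining V) (m s γ : ℝ) : Prop :=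
  ∀ u₀ : EnergySpace hV m s, ∃ u : ℝ → EnergySpace hV m s,
    IsSolution γ u₀ u ∧ (∀ w, IsSolution γ u₀ w → w = u) ∧
      ∀ t, mass (u t) = mass u₀ ∧ energy γ (u t) = energy γ u₀

/-- The set `S_M` of ground states: the minimizers of `E` on `{v ∈ Σ^s : ‖v‖₂² = M}`. -/
def groundStates {N : ℕ} {V : Space N → ℝ} (hV : IsConfining V) (m s γ M : ℝ) :
    Set (EnergySpace hV m s) :=
  {v | mass v = M ∧ ∀ w : EnergySpace hV m s, mass w = M → energy γ v ≤ energy γ w}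

end FracHartree

end

/-! This is the Cazenave–Lions argument. If stability failed, there would be initial data
approaching `S_M` whose solutions at some times stay a fixed distance from `S_M`. Mass and energy
are conserved, so these later states form a minimizing sequence up to a vanishing error in the mass
constraint. It therefore suffices that such sequences have subsequences converging in `Σ^s` to a
ground state (`IsSubcritical.exists_subseq_tendsto`). The equation enters only through uniqueness
and the two conservation laws.

Compactness is cheap because `V` confines: the embedding `Σ^s ⊆ L²` is compact
(`exists_subseq_cauchySeq_toL2`). Along an `L²`-Cauchy subsequence midpoints have almost the right
mass, hence almost at least the minimal energy, and the quartic term barely changes. The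
parallelogram law in `Σ^s` then makes the sequence Cauchy in the energy norm, so no weak lower
semicontinuity is needed.

The analytic input is that the Hartree energy is subcritical (`isSubcritical_hartreeEnergy`). A
Morrey estimate, `∫_{B(x,r)} |v|² ≤ C ‖v‖² r^{2s}`, says that `|v|² dx` is `2s`-dimensional
uniformly in `x`. Since `γ < 2s`, its Riesz potential is bounded by `η ‖v‖² + C_η ‖v‖₂²` with `η`
arbitrarily small. This gives coercivity of the energy at fixed mass as well as `L²`-continuity of
the quartic term on bounded sets. It replaces the Hardy–Littlewood–Sobolev and Gagliardo–Nirenberg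
inequalities. -/

noncomputable section

/-! ### Abstract stability for a subcritical quartic energy on a Hilbert space. -/

namespace OrbitalStability

variable {X H : Type*} [NormedAddCommGroup X] [InnerProductSpace ℂ X]
  [NormedAddCommGroup H] [InnerProductSpace ℂ H]

/-- The energy `½ ‖v‖² - ¼ D v` attached to an attractive quartic functional `D`. -/
def quarticEnergy (D : X → ℝ) (v : X) : ℝ :=
  1 / 2 * ‖v‖ ^ 2 - 1 / 4 * D v

/-- The minimizers of `quarticEnergy D` under the constraint `‖T v‖² = M`. -/
def minimizers (T : X →L[ℂ] H) (D : X → ℝ) (M : ℝ) : Set X :=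
  {v | ‖T v‖ ^ 2 = M ∧ ∀ w, ‖T w‖ ^ 2 = M → quarticEnergy D v ≤ quarticEnergy D w}

/-- Quartic homogeneous functionals that are subcritical with respect to the pair of norms
`‖v‖`, `‖T v‖`, and uniformly continuous for `‖T ·‖` on bounded sets. -/
structure IsSubcritical (T : X →L[ℂ] H) (D : X → ℝ) : Prop where
  nonneg : ∀ v, 0 ≤ D v
  smul : ∀ (c : ℝ) v, D ((c : ℂ) • v) = c ^ 4 * D v
  bound : ∀ η : ℝ, 0 < η → ∃ C : ℝ, ∀ v, D v ≤ (η * ‖v‖ ^ 2 + C * ‖T v‖ ^ 2) * ‖T v‖ ^ 2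
  uniform : ∀ R ε : ℝ, 0 < ε → ∃ δ : ℝ, 0 < δ ∧ ∀ u v, ‖u‖ ≤ R → ‖v‖ ≤ R → ‖T (u - v)‖ < δ →
    |D u - D v| < ε

variable {T : X →L[ℂ] H} {D : X → ℝ}

/-- Coercivity: with `η = 1 / (K + 1)` and mass at most `K`, the quartic term is at most `‖v‖² + |C|
K²`. A quarter of it absorbs only half of the quadratic part. -/
theorem IsSubcritical.exists_norm_le (hD : IsSubcritical T D) (K : ℝ) :
    ∃ R : ℝ, 0 ≤ R ∧ ∀ v, ‖T v‖ ^ 2 ≤ K → quarticEnergy D v ≤ K → ‖v‖ ≤ R := by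
  rcases lt_or_ge K 0 with hK | hK
  · exact ⟨0, le_rfl, fun v hv => absurd (hv.trans_lt hK) (not_lt.2 (sq_nonneg _))⟩
  obtain ⟨C, hC⟩ := hD.bound (1 / (K + 1)) (by positivity)
  refine ⟨√(4 * K + |C| * K ^ 2), Real.sqrt_nonneg _, fun v hv hE => Real.le_sqrt_of_sq_le ?_⟩
  have h1 := hC v
  unfold quarticEnergy at hE
  have h2 : (1 / (K + 1) * ‖v‖ ^ 2 + C * ‖T v‖ ^ 2) * ‖T v‖ ^ 2
      ≤ (1 / (K + 1) * ‖v‖ ^ 2 + |C| * K) * K := by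
    have : C * ‖T v‖ ^ 2 ≤ |C| * K :=
      mul_le_mul (le_abs_self C) hv (by positivity) (by positivity)
    have h3 : 1 / (K + 1) * ‖v‖ ^ 2 + C * ‖T v‖ ^ 2 ≤ 1 / (K + 1) * ‖v‖ ^ 2 + |C| * K := by
      linarith
    exact (mul_le_mul_of_nonneg_right h3 (by positivity)).trans
      (mul_le_mul_of_nonneg_left hv (by positivity))
  have h4 : 1 / (K + 1) * ‖v‖ ^ 2 * K ≤ ‖v‖ ^ 2 := by
    have : 1 / (K + 1) * ‖v‖ ^ 2 * K = ‖v‖ ^ 2 * (K / (K + 1)) := by ring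
    rw [this]
    exact mul_le_of_le_one_right (by positivity) ((div_le_one (by positivity)).2 (by linarith))
  nlinarith

theorem IsSubcritical.exists_le (hD : IsSubcritical T D) (R : ℝ) :
    ∃ B : ℝ, 0 ≤ B ∧ ∀ v, ‖v‖ ≤ R → D v ≤ B := by
  obtain ⟨C, hC⟩ := hD.bound 1 one_pos
  refine ⟨(R ^ 2 + |C| * (‖T‖ * R) ^ 2) * (‖T‖ * R) ^ 2, by positivity, fun v hv => ?_⟩
  have hR : 0 ≤ R := (norm_nonneg v).trans hv
  have h1 : ‖T v‖ ≤ ‖T‖ * R := (T.le_opNorm v).trans (by gcongr)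
  calc D v ≤ (1 * ‖v‖ ^ 2 + C * ‖T v‖ ^ 2) * ‖T v‖ ^ 2 := hC v
    _ ≤ (1 * ‖v‖ ^ 2 + |C| * ‖T v‖ ^ 2) * ‖T v‖ ^ 2 := by gcongr; exact le_abs_self C
    _ ≤ _ := by rw [one_mul]; gcongr

/-- The minimal energy depends lower semicontinuously on the constraint. -/
theorem IsSubcritical.exists_sub_le_quarticEnergy (hD : IsSubcritical T D) {M : ℝ} (hM : 0 < M)
    {g : X} (hg : g ∈ minimizers T D M) (R : ℝ) {ε : ℝ} (hε : 0 < ε) :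
    ∃ δ : ℝ, 0 < δ ∧ ∀ w, ‖w‖ ≤ R → |‖T w‖ ^ 2 - M| < δ →
      quarticEnergy D g - ε ≤ quarticEnergy D w := by
  obtain ⟨B, hB0, hB⟩ := hD.exists_le R
  -- Rescaling `w` of mass `t` to mass `M` multiplies the quadratic part by `M / t` and the quartic
  -- part by `(M / t)²`; `f t` bounds the resulting increase of the energy.
  let f : ℝ → ℝ := fun t => |M / t - 1| * (R ^ 2 / 2) + |(M / t) ^ 2 - 1| * (B / 4)
  have hf : ContinuousAt f M := by
    have : ContinuousAt (fun t : ℝ => M / t) M := continuousAt_const.div continuousAt_id hM.ne'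
    fun_prop
  have hfM : f M = 0 := by simp [f, hM.ne']
  obtain ⟨δ, hδ, hδf⟩ := Metric.continuousAt_iff.1 hf ε hε
  refine ⟨min δ (M / 2), by positivity, fun w hwR hw => ?_⟩
  have hR : 0 ≤ R := (norm_nonneg w).trans hwR
  set t := ‖T w‖ ^ 2 with ht
  have htpos : 0 < t := by
    have := (abs_lt.1 (hw.trans_le (min_le_right _ _))).1
    linarith
  have h1 : f t < ε := by
    have := hδf (x := t) (by rw [Real.dist_eq]; exact hw.trans_le (min_le_left _ _))
    rw [hfM, Real.dist_0_eq_abs] at this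
    exact (le_abs_self _).trans_lt this
  set c := √(M / t) with hc
  have hc2 : c ^ 2 = M / t := Real.sq_sqrt (by positivity)
  have h2 : ‖T ((c : ℂ) • w)‖ ^ 2 = M := by
    rw [map_smul, norm_smul, mul_pow, Complex.norm_real, Real.norm_eq_abs, sq_abs, hc2, ← ht]
    field_simp
  have h3 := hg.2 _ h2
  have h4 : quarticEnergy D ((c : ℂ) • w) = quarticEnergy D w + (M / t - 1) * (‖w‖ ^ 2 / 2)
      - ((M / t) ^ 2 - 1) * (D w / 4) := by
    unfold quarticEnergy
    rw [hD.smul, norm_smul, mul_pow, Complex.norm_real, Real.norm_eq_abs, sq_abs,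
      show c ^ 4 = (c ^ 2) ^ 2 by ring, hc2]
    ring
  have h5 : (M / t - 1) * (‖w‖ ^ 2 / 2) ≤ |M / t - 1| * (R ^ 2 / 2) := by
    refine mul_le_mul (le_abs_self _) ?_ (by positivity) (by positivity)
    gcongr
  have h6 : -(((M / t) ^ 2 - 1) * (D w / 4)) ≤ |(M / t) ^ 2 - 1| * (B / 4) := by
    rw [← neg_mul]
    have := hD.nonneg w
    refine mul_le_mul (neg_le_abs _) ?_ (by positivity) (by positivity)
    linarith [hB w hwR]
  have h7 : f t = |M / t - 1| * (R ^ 2 / 2) + |(M / t) ^ 2 - 1| * (B / 4) := rfl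
  linarith

/-- The parallelogram law rewritten with energies. If `u` and `v` are almost minimizing, the
midpoint is almost admissible and `D` hardly varies, the right-hand side is small. -/
theorem norm_sub_sq_eq_quarticEnergy (u v : X) :
    ‖u - v‖ ^ 2 = 4 * quarticEnergy D u + 4 * quarticEnergy D v
      - 8 * quarticEnergy D ((1 / 2 : ℂ) • (u + v))
      + (D u - D ((1 / 2 : ℂ) • (u + v))) + (D v - D ((1 / 2 : ℂ) • (u + v))) := by
  have h1 := parallelogram_law_with_norm ℂ u v
  have h2 : ‖(1 / 2 : ℂ) • (u + v)‖ = 1 / 2 * ‖u + v‖ := by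
    rw [norm_smul]; norm_num
  unfold quarticEnergy
  rw [h2]
  linear_combination h1

/-- Minimizing sequences are relatively compact. -/
theorem IsSubcritical.exists_subseq_tendsto [CompleteSpace X] (hD : IsSubcritical T D)
    (hT : ∀ (u : ℕ → X) (R : ℝ), (∀ n, ‖u n‖ ≤ R) →
      ∃ φ : ℕ → ℕ, StrictMono φ ∧ CauchySeq (fun n => T (u (φ n))))
    {M : ℝ} (hM : 0 < M) {g : X} (hg : g ∈ minimizers T D M) {w : ℕ → X}
    (hwM : Filter.Tendsto (fun n => ‖T (w n)‖ ^ 2) Filter.atTop (nhds M))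
    (hwE : Filter.Tendsto (fun n => quarticEnergy D (w n)) Filter.atTop
      (nhds (quarticEnergy D g))) :
    ∃ φ : ℕ → ℕ, StrictMono φ ∧ ∃ v ∈ minimizers T D M,
      Filter.Tendsto (fun n => w (φ n)) Filter.atTop (nhds v) := by
  obtain ⟨R, hR⟩ : ∃ R, ∀ n, ‖w n‖ ≤ R := by
    obtain ⟨K₁, hK₁⟩ := hwM.bddAbove_range
    obtain ⟨K₂, hK₂⟩ := hwE.bddAbove_range
    obtain ⟨R, -, hR⟩ := hD.exists_norm_le (max K₁ K₂)
    exact ⟨R, fun n => hR _ ((hK₁ ⟨n, rfl⟩).trans (le_max_left _ _))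
      ((hK₂ ⟨n, rfl⟩).trans (le_max_right _ _))⟩
  obtain ⟨φ, hφ, hTφ⟩ := hT w R hR
  have hwM' := hwM.comp hφ.tendsto_atTop
  have hwE' := hwE.comp hφ.tendsto_atTop
  have hcauchy : CauchySeq (fun n => w (φ n)) := by
    rw [Metric.cauchySeq_iff]
    intro ε hε
    -- The energies contribute `(4 + 4 + 8) ε'` and the differences of `D` contribute `2 ε'`; the
    -- total `18 ε'` is below `ε²`.
    set ε' := ε ^ 2 / 36 with hε'
    have hε'pos : 0 < ε' := by positivity
    obtain ⟨δ₁, hδ₁, h₁⟩ := hD.uniform R ε' hε'pos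
    obtain ⟨δ₂, hδ₂, h₂⟩ := hD.exists_sub_le_quarticEnergy hM hg R hε'pos
    obtain ⟨N₁, hN₁⟩ := Metric.cauchySeq_iff.1 hTφ δ₁ hδ₁
    obtain ⟨N₂, hN₂⟩ := Filter.eventually_atTop.1
      (Filter.Tendsto.eventually_lt_const (u := quarticEnergy D g + ε') (by linarith) hwE')
    -- By the parallelogram law in `H`, the midpoint's mass is the mean of the two masses minus `¼
    -- ‖T u - T v‖²`, which vanishes along the subsequence.
    have hmid : Filter.Tendsto (fun p : ℕ × ℕ => ‖T ((1 / 2 : ℂ) • (w (φ p.1) + w (φ p.2)))‖ ^ 2)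
        Filter.atTop (nhds M) := by
      have hd := cauchySeq_iff_tendsto_dist_atTop_0.1 hTφ
      have h1 : Filter.Tendsto (fun p : ℕ × ℕ => ‖T (w (φ p.1))‖ ^ 2) Filter.atTop (nhds M) := by
        rw [← Filter.prod_atTop_atTop_eq]; exact hwM'.comp Filter.tendsto_fst
      have h2 : Filter.Tendsto (fun p : ℕ × ℕ => ‖T (w (φ p.2))‖ ^ 2) Filter.atTop (nhds M) := by
        rw [← Filter.prod_atTop_atTop_eq]; exact hwM'.comp Filter.tendsto_snd
      have h3 := ((h1.add h2).const_mul (1 / 2)).sub ((hd.pow 2).const_mul (1 / 4))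
      have h4 : 1 / 2 * (M + M) - 1 / 4 * 0 ^ 2 = M := by ring
      rw [h4] at h3
      refine h3.congr fun p => ?_
      have h5 := parallelogram_law_with_norm ℂ (T (w (φ p.1))) (T (w (φ p.2)))
      have h6 : ‖T ((1 / 2 : ℂ) • (w (φ p.1) + w (φ p.2)))‖
          = 1 / 2 * ‖T (w (φ p.1)) + T (w (φ p.2))‖ := by
        rw [map_smul, map_add, norm_smul]; norm_num
      rw [h6, dist_eq_norm]
      linear_combination (-1 / 4 : ℝ) * h5
    obtain ⟨N₃, hN₃⟩ := (Filter.eventually_atTop_prod_self.1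
      (Metric.tendsto_nhds.1 hmid δ₂ hδ₂))
    refine ⟨max N₁ (max N₂ N₃), fun k hk l hl => ?_⟩
    obtain ⟨hk1, hk2, hk3⟩ : N₁ ≤ k ∧ N₂ ≤ k ∧ N₃ ≤ k := by simpa using hk
    obtain ⟨hl1, hl2, hl3⟩ : N₁ ≤ l ∧ N₂ ≤ l ∧ N₃ ≤ l := by simpa using hl
    set u := w (φ k)
    set v := w (φ l)
    set z := (1 / 2 : ℂ) • (u + v) with hz
    have huR : ‖u‖ ≤ R := hR _
    have hvR : ‖v‖ ≤ R := hR _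
    have hzR : ‖z‖ ≤ R := by
      have : ‖z‖ = 1 / 2 * ‖u + v‖ := by rw [hz, norm_smul]; norm_num
      have := norm_add_le u v
      linarith
    have hTuv : ‖T (u - v)‖ < δ₁ := by
      have := hN₁ k hk1 l hl1
      rwa [dist_eq_norm, ← map_sub] at this
    have hhalf : ‖T ((1 / 2 : ℂ) • (u - v))‖ < δ₁ := by
      rw [map_smul, norm_smul, show ‖(1 / 2 : ℂ)‖ = 1 / 2 by norm_num]
      have := norm_nonneg (T (u - v))
      linarith
    have hDu : |D u - D z| < ε' := by
      refine h₁ u z huR hzR ?_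
      have : u - z = (1 / 2 : ℂ) • (u - v) := by rw [hz]; module
      rwa [this]
    have hDv : |D v - D z| < ε' := by
      refine h₁ v z hvR hzR ?_
      have : v - z = -((1 / 2 : ℂ) • (u - v)) := by rw [hz]; module
      rwa [this, map_neg, norm_neg]
    have hEz := h₂ z hzR (hN₃ k l hk3 hl3)
    have hEu : quarticEnergy D u < quarticEnergy D g + ε' := hN₂ k hk2
    have hEv : quarticEnergy D v < quarticEnergy D g + ε' := hN₂ l hl2
    have hkey := norm_sub_sq_eq_quarticEnergy (D := D) u v
    rw [← hz] at hkey
    have h8 : ‖u - v‖ ^ 2 < ε ^ 2 := by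
      have := (abs_lt.1 hDu).2
      have := (abs_lt.1 hDv).2
      have : ε ^ 2 = 36 * ε' := by rw [hε']; ring
      linarith
    rw [dist_eq_norm]
    exact lt_of_pow_lt_pow_left₀ 2 hε.le h8
  obtain ⟨v, hv⟩ := cauchySeq_tendsto_of_complete hcauchy
  have hTv : Filter.Tendsto (fun n => ‖T (w (φ n))‖ ^ 2) Filter.atTop (nhds (‖T v‖ ^ 2)) :=
    (((T.continuous.tendsto v).comp hv).norm).pow 2
  have hvM : ‖T v‖ ^ 2 = M := tendsto_nhds_unique hTv hwM'
  have hvR : ‖v‖ ≤ R := le_of_tendsto hv.norm (Filter.Eventually.of_forall fun n => hR _)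
  have hDv : Filter.Tendsto (fun n => D (w (φ n))) Filter.atTop (nhds (D v)) := by
    rw [Metric.tendsto_atTop]
    intro ε hε
    obtain ⟨δ, hδ, h⟩ := hD.uniform R ε hε
    have h0 : Filter.Tendsto (fun n => T (w (φ n))) Filter.atTop (nhds (T v)) :=
      (T.continuous.tendsto v).comp hv
    obtain ⟨N, hN⟩ := Metric.tendsto_atTop.1 h0 δ hδ
    refine ⟨N, fun n hn => h _ _ (hR _) hvR ?_⟩
    have := hN n hn
    rwa [dist_eq_norm, ← map_sub] at this
  have hvE : quarticEnergy D v = quarticEnergy D g :=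
    tendsto_nhds_unique (((hv.norm.pow 2).const_mul _).sub (hDv.const_mul _)) hwE'
  exact ⟨φ, hφ, v, ⟨hvM, fun x hx => hvE.trans_le (hg.2 x hx)⟩, hv⟩

theorem tendsto_norm_sq_sub_norm_sq {ι Y : Type*} [NormedAddCommGroup Y] {l : Filter ι}
    (a b : ι → Y) (B : ℝ) (ha : ∀ n, ‖a n‖ ≤ B) (hb : ∀ n, ‖b n‖ ≤ B)
    (hab : Filter.Tendsto (fun n => ‖a n - b n‖) l (nhds 0)) :
    Filter.Tendsto (fun n => ‖a n‖ ^ 2 - ‖b n‖ ^ 2) l (nhds 0) := by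
  refine squeeze_zero_norm (a := fun n => ‖a n - b n‖ * (B + B)) (fun n => ?_) ?_
  · rw [sq_sub_sq, mul_comm, norm_mul]
    have := norm_nonneg (a n)
    have := norm_nonneg (b n)
    refine mul_le_mul ?_ ?_ (norm_nonneg _) (norm_nonneg _)
    · exact abs_norm_sub_norm_le _ _
    · rw [Real.norm_of_nonneg (by positivity)]
      exact add_le_add (ha n) (hb n)
  · simpa using hab.mul_const (B + B)

/-- Stability of the set of minimizers under the motions that conserve `‖T v‖` and the energy. -/
theorem IsSubcritical.stable [CompleteSpace X] (hD : IsSubcritical T D)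
    (hT : ∀ (u : ℕ → X) (R : ℝ), (∀ n, ‖u n‖ ≤ R) →
      ∃ φ : ℕ → ℕ, StrictMono φ ∧ CauchySeq (fun n => T (u (φ n))))
    {M : ℝ} (hM : 0 < M) {ε : ℝ} (hε : 0 < ε) :
    ∃ δ : ℝ, 0 < δ ∧ ∀ u w : X,
      Metric.infEDist u (minimizers T D M) < ENNReal.ofReal δ →
      ‖T w‖ ^ 2 = ‖T u‖ ^ 2 → quarticEnergy D w = quarticEnergy D u →
      Metric.infEDist w (minimizers T D M) < ENNReal.ofReal ε := by
  by_contra! hcon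
  choose u w hu hwu hEwu hw using fun n : ℕ => hcon (1 / ((n : ℝ) + 1)) (by positivity)
  -- The distance to an empty set is `⊤`, so the assumption itself supplies minimizers; their
  -- existence need not be proved.
  have hex : ∀ n, ∃ g ∈ minimizers T D M, dist (u n) g < 1 / ((n : ℝ) + 1) := fun n => by
    obtain ⟨g, hg, hlt⟩ := Metric.infEDist_lt_iff.1 (hu n)
    exact ⟨g, hg, by rwa [edist_lt_ofReal] at hlt⟩
  choose g hg hgu using hex
  have hd : Filter.Tendsto (fun n => ‖u n - g n‖) Filter.atTop (nhds 0) :=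
    squeeze_zero (fun n => norm_nonneg _) (fun n => by rw [← dist_eq_norm]; exact (hgu n).le)
      tendsto_one_div_add_atTop_nhds_zero_nat
  have hEg : ∀ n, quarticEnergy D (g n) = quarticEnergy D (g 0) := fun n =>
    le_antisymm ((hg n).2 _ (hg 0).1) ((hg 0).2 _ (hg n).1)
  obtain ⟨R, hR0, hR⟩ := hD.exists_norm_le (max M (quarticEnergy D (g 0)))
  have hgR : ∀ n, ‖g n‖ ≤ R := fun n =>
    hR _ ((hg n).1.trans_le (le_max_left _ _)) ((hEg n).trans_le (le_max_right _ _))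
  have huR : ∀ n, ‖u n‖ ≤ R + 1 := fun n => by
    have h1 := (hgu n).le
    have h2 : 1 / ((n : ℝ) + 1) ≤ 1 := by
      rw [div_le_one (by positivity)]; linarith [Nat.cast_nonneg (α := ℝ) n]
    rw [dist_eq_norm] at h1
    have := norm_le_norm_add_norm_sub' (u n) (g n)
    linarith [hgR n]
  have hTd : Filter.Tendsto (fun n => ‖T (u n - g n)‖) Filter.atTop (nhds 0) :=
    squeeze_zero (fun n => norm_nonneg _) (fun n => T.le_opNorm _)
      (by simpa using hd.const_mul ‖T‖)
  have hwM : Filter.Tendsto (fun n => ‖T (w n)‖ ^ 2) Filter.atTop (nhds M) := by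
    have h1 := tendsto_norm_sq_sub_norm_sq (fun n => T (u n)) (fun n => T (g n)) (‖T‖ * (R + 1))
      (fun n => (T.le_opNorm _).trans (by gcongr; exact huR n))
      (fun n => (T.le_opNorm _).trans (by gcongr; linarith [hgR n]))
      (by simpa only [map_sub] using hTd)
    have h2 := h1.add_const M
    rw [zero_add] at h2
    refine h2.congr fun n => ?_
    rw [hwu, (hg n).1]
    ring
  have hDd : Filter.Tendsto (fun n => D (u n) - D (g n)) Filter.atTop (nhds 0) := by
    rw [Metric.tendsto_atTop]
    intro r hr
    obtain ⟨δ, hδ, h⟩ := hD.uniform (R + 1) r hr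
    obtain ⟨N, hN⟩ := Metric.tendsto_atTop.1 hTd δ hδ
    refine ⟨N, fun n hn => ?_⟩
    rw [Real.dist_0_eq_abs]
    refine h _ _ (huR n) ((hgR n).trans (by linarith)) ?_
    simpa using hN n hn
  have hwE : Filter.Tendsto (fun n => quarticEnergy D (w n)) Filter.atTop
      (nhds (quarticEnergy D (g 0))) := by
    have h1 := tendsto_norm_sq_sub_norm_sq u g (R + 1) huR (fun n => (hgR n).trans (by linarith)) hd
    have h2 := ((h1.const_mul (1 / 2)).sub (hDd.const_mul (1 / 4))).add_const
      (quarticEnergy D (g 0))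
    rw [mul_zero, mul_zero, sub_zero, zero_add] at h2
    refine h2.congr fun n => ?_
    rw [hEwu, ← hEg n]
    unfold quarticEnergy
    ring
  obtain ⟨φ, -, v, hv, hlim⟩ := hD.exists_subseq_tendsto hT hM (hg 0) hwM hwE
  obtain ⟨n, hn⟩ := ((Metric.tendsto_nhds.1 hlim) ε hε).exists
  have h1 : Metric.infEDist (w (φ n)) (minimizers T D M) < ENNReal.ofReal ε :=
    Metric.infEDist_lt_iff.2 ⟨v, hv, edist_lt_ofReal.2 hn⟩
  exact absurd h1 (not_lt.2 (hw _))

end OrbitalStability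

end

/-! ### Riesz potentials of measures with power growth on balls. -/

noncomputable section

namespace OrbitalStability

/-- The constant of `lintegral_closedBall_inv_rpow_le`. -/
def rieszConst (a b : ℝ) : ℝ :=
  2 ^ b * (1 - (1 / 2 : ℝ) ^ (a - b))⁻¹

theorem half_rpow_lt_one {t : ℝ} (ht : 0 < t) : (1 / 2 : ℝ) ^ t < 1 :=
  Real.rpow_lt_one (by norm_num) (by norm_num) ht

theorem rieszConst_nonneg {a b : ℝ} (hab : b < a) : 0 ≤ rieszConst a b :=
  mul_nonneg (by positivity)
    (inv_nonneg.2 (sub_nonneg.2 (half_rpow_lt_one (sub_pos.2 hab)).le))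

/-- Riesz potentials of measures that are `a`-dimensional near `x`. -/
theorem lintegral_closedBall_inv_rpow_le {E : Type*} [NormedAddCommGroup E] [MeasurableSpace E]
    [BorelSpace E] (μ : Measure E) (x : E) {a b A ρ : ℝ} (hb : 0 < b) (hab : b < a) (hA : 0 ≤ A)
    (hρ : 0 < ρ)
    (h : ∀ r, 0 < r → r ≤ ρ → μ (Metric.closedBall x r) ≤ ENNReal.ofReal (A * r ^ a)) :
    ∫⁻ y in Metric.closedBall x ρ, ENNReal.ofReal (1 / ‖x - y‖ ^ b) ∂μ
      ≤ ENNReal.ofReal (rieszConst a b * A * ρ ^ (a - b)) := by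
  -- Dyadic decomposition: on the shell `r j / 2 < ‖x - y‖ ≤ r j` the kernel is at most `c j`. The
  -- resulting series is geometric with ratio `2^{-(a-b)} < 1`.
  let r : ℕ → ℝ := fun j => ρ * (1 / 2) ^ j
  have hr : ∀ j, 0 < r j := fun j => by positivity
  have hrρ : ∀ j, r j ≤ ρ := fun j =>
    mul_le_of_le_one_right hρ.le (pow_le_one₀ (by norm_num) (by norm_num))
  let c : ℕ → ℝ := fun j => 1 / (r j / 2) ^ b
  have hpt : ∀ y ∈ Metric.closedBall x ρ, ENNReal.ofReal (1 / ‖x - y‖ ^ b)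
      ≤ ∑' j, (Metric.closedBall x (r j)).indicator (fun _ => ENNReal.ofReal (c j)) y := by
    intro y hy
    rcases eq_or_ne x y with rfl | hxy
    -- At `y = x` the kernel has the value `1 / 0 = 0`.
    · simp [Real.zero_rpow hb.ne']
    have hd : 0 < ‖x - y‖ := norm_pos_iff.2 (sub_ne_zero.2 hxy)
    have hdρ : ‖x - y‖ ≤ ρ := by rwa [Metric.mem_closedBall', dist_eq_norm] at hy
    obtain ⟨j, hj1, hj2⟩ := exists_nat_pow_near_of_lt_one (x := ‖x - y‖ / ρ) (y := (1 / 2 : ℝ))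
      (by positivity) ((div_le_one hρ).2 hdρ) (by norm_num) (by norm_num)
    rw [lt_div_iff₀ hρ, pow_succ] at hj1
    rw [div_le_iff₀ hρ] at hj2
    refine le_trans ?_ (ENNReal.le_tsum j)
    rw [Set.indicator_of_mem (by rw [Metric.mem_closedBall', dist_eq_norm]; simp only [r]; linarith)]
    refine ENNReal.ofReal_le_ofReal (one_div_le_one_div_of_le (by have := hr j; positivity) ?_)
    refine Real.rpow_le_rpow (by have := hr j; positivity) ?_ hb.le
    simp only [r]
    linarith
  have hq0 : 0 ≤ (1 / 2 : ℝ) ^ (a - b) := by positivity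
  have hq1 := half_rpow_lt_one (sub_pos.2 hab)
  have hterm : ∀ j, c j * (A * r j ^ a) = 2 ^ b * A * ρ ^ (a - b) * ((1 / 2 : ℝ) ^ (a - b)) ^ j := by
    intro j
    have h1 : r j ^ a = r j ^ (a - b) * r j ^ b := by
      rw [← Real.rpow_add (hr j), sub_add_cancel]
    have h2 : r j ^ (a - b) = ρ ^ (a - b) * ((1 / 2 : ℝ) ^ (a - b)) ^ j := by
      simp only [r]
      rw [Real.mul_rpow hρ.le (by positivity), ← Real.rpow_natCast, ← Real.rpow_natCast,
        ← Real.rpow_mul (by norm_num), ← Real.rpow_mul (by norm_num), mul_comm (j : ℝ)]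
    have h3 : 0 < r j ^ b := Real.rpow_pos_of_pos (hr j) b
    simp only [c]
    rw [Real.div_rpow (hr j).le (by norm_num), h1, h2]
    field_simp
  calc ∫⁻ y in Metric.closedBall x ρ, ENNReal.ofReal (1 / ‖x - y‖ ^ b) ∂μ
      ≤ ∫⁻ y in Metric.closedBall x ρ,
          ∑' j, (Metric.closedBall x (r j)).indicator (fun _ => ENNReal.ofReal (c j)) y ∂μ :=
        setLIntegral_mono' measurableSet_closedBall hpt
    _ ≤ ∫⁻ y, ∑' j, (Metric.closedBall x (r j)).indicator (fun _ => ENNReal.ofReal (c j)) y ∂μ :=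
        setLIntegral_le_lintegral _ _
    _ = ∑' j, ENNReal.ofReal (c j) * μ (Metric.closedBall x (r j)) := by
        rw [lintegral_tsum fun j =>
          (measurable_const.indicator measurableSet_closedBall).aemeasurable]
        simp_rw [lintegral_indicator_const measurableSet_closedBall]
    _ ≤ ∑' j, ENNReal.ofReal (2 ^ b * A * ρ ^ (a - b) * ((1 / 2 : ℝ) ^ (a - b)) ^ j) := by
        refine ENNReal.tsum_le_tsum fun j => ?_
        rw [← hterm, ENNReal.ofReal_mul (by have := hr j; positivity)]
        gcongr
        exact h _ (hr j) (hrρ j)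
    _ = ENNReal.ofReal (∑' j : ℕ, 2 ^ b * A * ρ ^ (a - b) * ((1 / 2 : ℝ) ^ (a - b)) ^ j) :=
        (ENNReal.ofReal_tsum_of_nonneg (fun j => by positivity)
          ((summable_geometric_of_lt_one hq0 hq1).mul_left _)).symm
    _ = _ := by
        rw [tsum_mul_left, tsum_geometric_of_lt_one hq0 hq1, rieszConst]
        congr 1
        ring

end OrbitalStability

end

/-! ### Frequency cutoffs and the Morrey estimate. -/

noncomputable section

namespace OrbitalStability

open FracHartree

variable {N : ℕ}

theorem lintegral_enorm_sq (f : L2 N) : ∫⁻ x, ‖f x‖ₑ ^ 2 = ENNReal.ofReal (‖f‖ ^ 2) := by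
  have h := eLpNorm_nnreal_pow_eq_lintegral (p := 2) (μ := (volume : Measure (Space N)))
    (f := f) (by norm_num)
  norm_num at h
  rw [← h, ENNReal.ofReal_pow (norm_nonneg _), ofReal_norm, Lp.enorm_def]

/-- On `L¹ ∩ L²` the inverse Fourier transform of `L²` is given by the Fourier integral. -/
theorem coeFn_fourierInv_of_integrable (f : L2 N) (hf : Integrable f) :
    (𝓕⁻ f : L2 N) =ᵐ[volume] 𝓕⁻ (f : Space N → ℂ) := by
  have hcont : Continuous (𝓕⁻ (f : Space N → ℂ)) := by
    rw [Real.fourierInv_eq_fourier_comp_neg]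
    exact VectorFourier.fourierIntegral_continuous Real.continuous_fourierChar
      (by exact continuous_inner) hf.comp_neg
  -- Both sides are tested against smooth compactly supported functions. The transform is moved onto
  -- the test function, by duality of tempered distributions for the `L²` transform and by Fubini
  -- for the integral.
  refine ae_eq_of_integral_contDiff_smul_eq ((Lp.memLp _).locallyIntegrable (by norm_num))
    hcont.locallyIntegrable fun g hg hgc => ?_
  have hg₁ : HasCompactSupport (Complex.ofRealCLM ∘ g) := hgc.comp_left rfl
  have hg₂ : ContDiff ℝ ∞ (Complex.ofRealCLM ∘ g) := by fun_prop
  set G := hg₁.toSchwartzMap hg₂ with hG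
  have hGg : ∀ x, G x = (g x : ℂ) := fun x => rfl
  have h1 := DFunLike.congr_fun (Lp.fourierInv_toTemperedDistribution_eq f) G
  rw [TemperedDistribution.fourierInv_apply, Lp.toTemperedDistribution_apply,
    Lp.toTemperedDistribution_apply] at h1
  have h2 : ∫ ξ, (𝓕⁻ G) ξ • f ξ = ∫ x, G x • (𝓕⁻ (f : Space N → ℂ)) x := by
    have h3 : ∫ ξ, 𝓕 (G : Space N → ℂ) ξ • f (-ξ) = ∫ x, G x • 𝓕 (fun ξ => f (-ξ)) x := by
      simpa using! VectorFourier.integral_fourierIntegral_smul_eq_flip (L := innerₗ (Space N))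
        Real.continuous_fourierChar continuous_inner G.integrable hf.comp_neg
    rw [Real.fourierInv_eq_fourier_comp_neg, ← h3, ← integral_neg_eq_self]
    refine integral_congr_ae (Filter.Eventually.of_forall fun ξ => ?_)
    simp [SchwartzMap.fourierInv_coe, Real.fourierInv_eq_fourier_neg]
  rw [h2] at h1
  simpa [hGg] using h1.symm

/-- Multiplication by the indicator function of `S`, on `L²`. -/
def cutoff (S : Set (Space N)) (hS : MeasurableSet S) : L2 N →ₗ[ℂ] L2 N where
  toFun f := ((Lp.memLp f).indicator hS).toLp _
  map_add' f g := by
    rw [← MemLp.toLp_add, MemLp.toLp_eq_toLp_iff]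
    filter_upwards [Lp.coeFn_add f g] with x hx
    by_cases h : x ∈ S
    · simp only [Pi.add_apply, Set.indicator_of_mem h, hx]
    · simp only [Pi.add_apply, Set.indicator_of_notMem h, add_zero]
  map_smul' c f := by
    rw [RingHom.id_apply, ← MemLp.toLp_const_smul, MemLp.toLp_eq_toLp_iff]
    filter_upwards [Lp.coeFn_smul c f] with x hx
    by_cases h : x ∈ S
    · simp only [Pi.smul_apply, Set.indicator_of_mem h, hx]
    · simp only [Pi.smul_apply, Set.indicator_of_notMem h, smul_zero]

theorem coeFn_cutoff {S : Set (Space N)} (hS : MeasurableSet S) (f : L2 N) :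
    cutoff S hS f =ᵐ[volume] S.indicator f :=
  ((Lp.memLp f).indicator hS).coeFn_toLp

theorem norm_cutoff_le {S : Set (Space N)} (hS : MeasurableSet S) (f : L2 N) :
    ‖cutoff S hS f‖ ≤ ‖f‖ := by
  apply Lp.norm_le_norm_of_ae_le
  filter_upwards [coeFn_cutoff hS f] with x hx
  rw [hx]
  exact norm_indicator_le_norm_self _ _

/-- A Chebyshev bound for the tail of `f` off `S`. It serves in frequency, with `g` the weighted
transform, and in space, with `g = √V f`. -/
theorem mul_norm_sub_cutoff_le {S : Set (Space N)} (hS : MeasurableSet S) {f g : L2 N} {A : ℝ}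
    (hA : 0 ≤ A) (h : ∀ᵐ x, x ∉ S → A * ‖f x‖ ≤ ‖g x‖) :
    A * ‖f - cutoff S hS f‖ ≤ ‖g‖ := by
  have h1 : ‖(A : ℂ) • (f - cutoff S hS f)‖ ≤ ‖g‖ := by
    apply Lp.norm_le_norm_of_ae_le
    filter_upwards [Lp.coeFn_smul (A : ℂ) (f - cutoff S hS f), Lp.coeFn_sub f (cutoff S hS f),
      coeFn_cutoff hS f, h] with x h1 h2 h3 h4
    rw [h1, Pi.smul_apply, h2, Pi.sub_apply, h3]
    by_cases hx : x ∈ S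
    · simp [hx]
    · simpa [hx, abs_of_nonneg hA] using h4 hx
  rwa [norm_smul, Complex.norm_real, Real.norm_of_nonneg hA] at h1

theorem integrable_cutoff_closedBall (K : ℝ) (f : L2 N) :
    Integrable (cutoff (Metric.closedBall 0 K) measurableSet_closedBall f) := by
  refine Integrable.congr ?_ (coeFn_cutoff measurableSet_closedBall f).symm
  rw [integrable_indicator_iff measurableSet_closedBall]
  exact ((Lp.memLp f).locallyIntegrable (by norm_num)).integrableOn_isCompact
    (isCompact_closedBall _ _)

theorem enorm_fourierInv_le (f : Space N → ℂ) (x : Space N) : ‖𝓕⁻ f x‖ₑ ≤ ∫⁻ ξ, ‖f ξ‖ₑ := by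
  rw [Real.fourierInv_eq]
  refine (enorm_integral_le_lintegral_enorm _).trans_eq ?_
  refine lintegral_congr fun ξ => ?_
  rw [← ofReal_norm, ← ofReal_norm, Circle.norm_smul]

theorem enorm_fourierInv_cutoff_le (K : ℝ) (f : L2 N) (x : Space N) :
    ‖𝓕⁻ (cutoff (Metric.closedBall 0 K) measurableSet_closedBall f : Space N → ℂ) x‖ₑ
      ≤ ∫⁻ ξ in Metric.closedBall 0 K, ‖f ξ‖ₑ := by
  refine (enorm_fourierInv_le _ x).trans_eq ?_
  rw [← lintegral_indicator measurableSet_closedBall]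
  refine lintegral_congr_ae ?_
  filter_upwards [coeFn_cutoff measurableSet_closedBall f] with ξ h
  rw [h, enorm_indicator_eq_indicator_enorm]

theorem lintegral_mul_sq_le {α : Type*} [MeasurableSpace α] {μ : Measure α} {f g : α → ℝ≥0∞}
    (hf : AEMeasurable f μ) (hg : AEMeasurable g μ) :
    (∫⁻ a, f a * g a ∂μ) ^ 2 ≤ (∫⁻ a, f a ^ 2 ∂μ) * ∫⁻ a, g a ^ 2 ∂μ := by
  have h := ENNReal.lintegral_mul_le_Lp_mul_Lq μ Real.HolderConjugate.two_two hf hg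
  simp only [Pi.mul_apply, ENNReal.rpow_two] at h
  calc _ ≤ _ := pow_le_pow_left' h 2
    _ = _ := by
      rw [mul_pow, ← ENNReal.rpow_natCast, ← ENNReal.rpow_natCast, ← ENNReal.rpow_mul,
        ← ENNReal.rpow_mul]
      norm_num

/-- The constant of `lintegral_closedBall_enorm_sq_le`. -/
def morreyConst (N : ℕ) (s : ℝ) : ℝ :=
  2 * ((volume (Metric.ball (0 : Space N) 1)).toReal ^ 2 * rieszConst N (2 * s)) + 2

theorem morreyConst_nonneg {s : ℝ} (hsN : 2 * s < N) : 0 ≤ morreyConst N s := by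
  have := rieszConst_nonneg hsN
  unfold morreyConst
  positivity

theorem volume_closedBall_eq (x : Space N) {r : ℝ} (hr : 0 ≤ r) :
    volume (Metric.closedBall x r)
      = ENNReal.ofReal ((volume (Metric.ball (0 : Space N) 1)).toReal * r ^ (N : ℝ)) := by
  rw [Measure.addHaar_closedBall _ _ hr, finrank_euclideanSpace_fin, mul_comm,
    ENNReal.ofReal_mul ENNReal.toReal_nonneg, ENNReal.ofReal_toReal measure_ball_lt_top.ne,
    Real.rpow_natCast]

/-- Cauchy–Schwarz with the weight `‖ξ‖^{-s}`, whose square is integrable near the origin because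
`2s < N`; the Riesz bound for Lebesgue measure evaluates it. -/
theorem sq_lintegral_closedBall_enorm_le {s : ℝ} (hs : 0 < s) (hsN : 2 * s < N) {w g : L2 N}
    (h : ∀ᵐ ξ, ‖ξ‖ ^ s * ‖w ξ‖ ≤ ‖g ξ‖) {K : ℝ} (hK : 0 < K) :
    (∫⁻ ξ in Metric.closedBall 0 K, ‖w ξ‖ₑ) ^ 2
      ≤ ENNReal.ofReal ((volume (Metric.ball (0 : Space N) 1)).toReal * rieszConst N (2 * s)
        * K ^ (N - 2 * s) * ‖g‖ ^ 2) := by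
  have hN : Nonempty (Fin N) := by
    rw [← Fin.pos_iff_nonempty]
    have : (0 : ℝ) < N := by linarith
    exact_mod_cast this
  have h0 : ∀ᵐ ξ : Space N, ξ ≠ 0 := by
    rw [ae_iff]
    simp
  have h1 : ∫⁻ ξ in Metric.closedBall 0 K, ‖w ξ‖ₑ
      ≤ ∫⁻ ξ in Metric.closedBall 0 K, ENNReal.ofReal (1 / ‖ξ‖ ^ s) * ‖g ξ‖ₑ := by
    refine lintegral_mono_ae (ae_restrict_of_ae ?_)
    filter_upwards [h, h0] with ξ hξ hξ0
    have hpos : 0 < ‖ξ‖ ^ s := Real.rpow_pos_of_pos (norm_pos_iff.2 hξ0) s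
    rw [← ofReal_norm, ← ofReal_norm, ← ENNReal.ofReal_mul (by positivity)]
    refine ENNReal.ofReal_le_ofReal ?_
    rw [one_div, inv_mul_eq_div, le_div_iff₀ hpos, mul_comm]
    exact hξ
  have h2 : ∫⁻ ξ in Metric.closedBall (0 : Space N) K, ENNReal.ofReal (1 / ‖ξ‖ ^ s) ^ 2
      ≤ ENNReal.ofReal (rieszConst N (2 * s) * (volume (Metric.ball (0 : Space N) 1)).toReal
        * K ^ (N - 2 * s)) := by
    refine le_trans (le_of_eq ?_) (lintegral_closedBall_inv_rpow_le volume (0 : Space N)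
      (by positivity) hsN ENNReal.toReal_nonneg hK fun r hr _ => (volume_closedBall_eq 0 hr.le).le)
    refine lintegral_congr fun ξ => ?_
    rw [← ENNReal.ofReal_pow (by positivity), zero_sub, norm_neg, div_pow, one_pow,
      ← Real.rpow_mul_natCast (norm_nonneg _)]
    norm_num [mul_comm]
  calc _ ≤ _ := pow_le_pow_left' h1 2
    _ ≤ _ := lintegral_mul_sq_le (by fun_prop) (Lp.aestronglyMeasurable g).enorm.restrict
    _ ≤ _ := mul_le_mul' h2 (setLIntegral_le_lintegral _ _)
    _ = _ := by
      have := rieszConst_nonneg hsN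
      rw [lintegral_enorm_sq, ← ENNReal.ofReal_mul (by positivity)]
      congr 1
      ring

/-- A Morrey estimate for functions with `s` derivatives in `L²`. -/
theorem lintegral_closedBall_enorm_sq_le {s : ℝ} (hs : 0 < s) (hsN : 2 * s < N) {v g : L2 N}
    (h : ∀ᵐ ξ, ‖ξ‖ ^ s * ‖(𝓕 v : L2 N) ξ‖ ≤ ‖g ξ‖) (x : Space N) {r : ℝ} (hr : 0 < r) :
    ∫⁻ y in Metric.closedBall x r, ‖v y‖ₑ ^ 2
      ≤ ENNReal.ofReal (morreyConst N s * ‖g‖ ^ 2 * r ^ (2 * s)) := by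
  -- At this frequency the two parts balance. The low part has squared supremum of order `K^{N-2s}`
  -- on a ball of volume of order `r^N`, the high part has squared `L²` norm at most `K^{-2s} ‖g‖²`,
  -- and both give `r^{2s}`.
  set K := r⁻¹ with hK
  have hKpos : 0 < K := inv_pos.2 hr
  have hrs := rieszConst_nonneg hsN
  set lo := cutoff (Metric.closedBall 0 K) measurableSet_closedBall (𝓕 v) with hlo
  set hi := 𝓕 v - lo with hhi
  have hv : v = 𝓕⁻ lo + 𝓕⁻ hi := by
    rw [← FourierTransform.fourierInv_add, hhi, add_sub_cancel]
    exact (FourierTransform.fourierInv_fourier_eq v).symm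
  have hhin : ‖(𝓕⁻ hi : L2 N)‖ ^ 2 ≤ ‖g‖ ^ 2 * r ^ (2 * s) := by
    have h1 : ‖(𝓕⁻ hi : L2 N)‖ = ‖hi‖ := (Lp.fourierTransformₗᵢ _ _).symm.norm_map hi
    have h2 : K ^ s * ‖hi‖ ≤ ‖g‖ := by
      refine mul_norm_sub_cutoff_le _ (by positivity) ?_
      filter_upwards [h] with ξ hξ hξK
      refine le_trans ?_ hξ
      have : K ≤ ‖ξ‖ := by
        rw [mem_closedBall_zero_iff, not_le] at hξK
        exact hξK.le
      gcongr
    have h3 : ‖hi‖ ≤ ‖g‖ * r ^ s := by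
      rw [hK, Real.inv_rpow hr.le, inv_mul_le_iff₀ (by positivity), mul_comm] at h2
      exact h2
    rw [h1]
    calc ‖hi‖ ^ 2 ≤ (‖g‖ * r ^ s) ^ 2 := by gcongr
      _ = _ := by rw [mul_pow, ← Real.rpow_mul_natCast hr.le]; norm_num [mul_comm]
  have hlon : ∫⁻ y in Metric.closedBall x r, ‖(𝓕⁻ lo : L2 N) y‖ₑ ^ 2
      ≤ ENNReal.ofReal ((volume (Metric.ball (0 : Space N) 1)).toReal ^ 2 * rieszConst N (2 * s)
        * ‖g‖ ^ 2 * r ^ (2 * s)) := by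
    calc _ ≤ ∫⁻ y in Metric.closedBall x r,
          ENNReal.ofReal ((volume (Metric.ball (0 : Space N) 1)).toReal * rieszConst N (2 * s)
            * K ^ (N - 2 * s) * ‖g‖ ^ 2) := by
          refine lintegral_mono_ae (ae_restrict_of_ae ?_)
          filter_upwards [coeFn_fourierInv_of_integrable lo (integrable_cutoff_closedBall K _)]
            with y hy
          rw [hy]
          exact (pow_le_pow_left' (enorm_fourierInv_cutoff_le K (𝓕 v) y) 2).trans
            (sq_lintegral_closedBall_enorm_le hs hsN h hKpos)
      _ = _ := by
          rw [setLIntegral_const, volume_closedBall_eq x hr.le, ← ENNReal.ofReal_mul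
            (by positivity)]
          congr 1
          have : K ^ ((N : ℝ) - 2 * s) * r ^ (N : ℝ) = r ^ (2 * s) := by
            rw [hK, Real.inv_rpow hr.le, ← Real.rpow_neg hr.le, ← Real.rpow_add hr]
            congr 1
            ring
          rw [← this]
          ring
  calc ∫⁻ y in Metric.closedBall x r, ‖v y‖ₑ ^ 2
      ≤ ∫⁻ y in Metric.closedBall x r,
          (2 * ‖(𝓕⁻ lo : L2 N) y‖ₑ ^ 2 + 2 * ‖(𝓕⁻ hi : L2 N) y‖ₑ ^ 2) := by
        refine lintegral_mono_ae (ae_restrict_of_ae ?_)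
        filter_upwards [Lp.coeFn_add (𝓕⁻ lo : L2 N) (𝓕⁻ hi)] with y hy
        rw [hv, hy, Pi.add_apply]
        have h1 : ‖(𝓕⁻ lo : L2 N) y + (𝓕⁻ hi : L2 N) y‖ ^ 2
            ≤ 2 * ‖(𝓕⁻ lo : L2 N) y‖ ^ 2 + 2 * ‖(𝓕⁻ hi : L2 N) y‖ ^ 2 := by
          have h1 := norm_add_le ((𝓕⁻ lo : L2 N) y) ((𝓕⁻ hi : L2 N) y)
          have h2 := sq_nonneg (‖(𝓕⁻ lo : L2 N) y‖ - ‖(𝓕⁻ hi : L2 N) y‖)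
          have h3 := pow_le_pow_left₀ (norm_nonneg _) h1 2
          linarith
        have h2 := ENNReal.ofReal_le_ofReal h1
        rwa [ENNReal.ofReal_add (by positivity) (by positivity),
          ENNReal.ofReal_mul (by positivity), ENNReal.ofReal_mul (by positivity),
          ENNReal.ofReal_pow (by positivity), ENNReal.ofReal_pow (by positivity),
          ENNReal.ofReal_pow (by positivity), ofReal_norm, ofReal_norm, ofReal_norm,
          ENNReal.ofReal_ofNat] at h2
    _ ≤ 2 * ENNReal.ofReal ((volume (Metric.ball (0 : Space N) 1)).toReal ^ 2
          * rieszConst N (2 * s) * ‖g‖ ^ 2 * r ^ (2 * s))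
        + 2 * ENNReal.ofReal (‖g‖ ^ 2 * r ^ (2 * s)) := by
        rw [lintegral_add_left' (by
            exact ((Lp.aestronglyMeasurable _).enorm.pow_const 2).const_mul 2 |>.restrict),
          lintegral_const_mul' _ _ (by norm_num), lintegral_const_mul' _ _ (by norm_num)]
        gcongr
        refine (setLIntegral_le_lintegral _ _).trans ?_
        rw [lintegral_enorm_sq]
        exact ENNReal.ofReal_le_ofReal hhin
    _ = _ := by
        have h2 : ∀ a : ℝ, 2 * ENNReal.ofReal a = ENNReal.ofReal (2 * a) := fun a => by
          rw [ENNReal.ofReal_mul (by norm_num), ENNReal.ofReal_ofNat]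
        rw [h2, h2, ← ENNReal.ofReal_add (by positivity) (by positivity), morreyConst]
        congr 1
        ring

end OrbitalStability

end

/-! ### Compactness of the embedding of the energy space into `L²`. -/

noncomputable section

namespace OrbitalStability

open FracHartree FracHartree.EnergySpace Filter Topology

variable {N : ℕ}

/-- Bounded sequences of a separable Hilbert space have weakly convergent subsequences. -/
theorem exists_subseq_tendsto_inner {H : Type*} [NormedAddCommGroup H] [InnerProductSpace ℂ H]
    [CompleteSpace H] [TopologicalSpace.SeparableSpace H] {x : ℕ → H} {R : ℝ}
    (hx : ∀ n, ‖x n‖ ≤ R) :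
    ∃ z : H, ∃ φ : ℕ → ℕ, StrictMono φ ∧
      ∀ g : H, Tendsto (fun n => ⟪g, x (φ n)⟫_ℂ) atTop (𝓝 ⟪g, z⟫_ℂ) := by
  have hmem : ∀ n, StrongDual.toWeakDual (InnerProductSpace.toDual ℂ H (x n)) ∈
      WeakDual.toStrongDual ⁻¹' Metric.closedBall (0 : StrongDual ℂ H) R := fun n => by
    simpa using hx n
  obtain ⟨ℓ, -, φ, hφ, hlim⟩ := WeakDual.isSeqCompact_closedBall ℂ H 0 R hmem
  refine ⟨(InnerProductSpace.toDual ℂ H).symm (WeakDual.toStrongDual ℓ), φ, hφ, fun g => ?_⟩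
  have h1 := ((WeakDual.eval_continuous g).tendsto ℓ).comp hlim
  have h2 := (Complex.continuous_conj.tendsto _).comp h1
  have h3 : ⟪g, (InnerProductSpace.toDual ℂ H).symm (WeakDual.toStrongDual ℓ)⟫_ℂ = conj (ℓ g) := by
    rw [← inner_conj_symm, InnerProductSpace.toDual_symm_apply]
    rfl
  rw [h3]
  refine h2.congr fun n => ?_
  rw [← inner_conj_symm]
  rfl

theorem cauchySeq_of_forall_approx {E : Type*} [SeminormedAddCommGroup E] {x : ℕ → E}
    (h : ∀ ε : ℝ, 0 < ε → ∃ y : ℕ → E, CauchySeq y ∧ ∀ n, ‖x n - y n‖ < ε) : CauchySeq x := by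
  rw [Metric.cauchySeq_iff]
  intro ε hε
  obtain ⟨y, hy, hxy⟩ := h (ε / 3) (by positivity)
  obtain ⟨n₀, hn₀⟩ := Metric.cauchySeq_iff.1 hy (ε / 3) (by positivity)
  refine ⟨n₀, fun k hk l hl => ?_⟩
  have h1 := hxy k
  have h2 := hxy l
  have h3 := hn₀ k hk l hl
  rw [← dist_eq_norm] at h1 h2
  rw [dist_comm] at h2
  linarith [dist_triangle4 (x k) (y k) (y l) (x l)]

/-- Point evaluation of a band-limited function is a bounded functional on `L²`, so weak convergence
of the transforms gives pointwise convergence. -/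
theorem exists_fourierInv_cutoff_eq_inner (K : ℝ) (x : Space N) :
    ∃ e : L2 N, ∀ z : L2 N,
      𝓕⁻ (cutoff (Metric.closedBall 0 K) measurableSet_closedBall z : Space N → ℂ) x
        = ⟪e, z⟫_ℂ := by
  have hmem : MemLp ((Metric.closedBall (0 : Space N) K).indicator
      (fun ξ => conj (Real.fourierChar ⟪ξ, x⟫_ℝ : ℂ))) 2 volume := by
    rw [memLp_indicator_iff_restrict measurableSet_closedBall]
    have : IsFiniteMeasure (volume.restrict (Metric.closedBall (0 : Space N) K)) :=
      ⟨by rw [Measure.restrict_apply_univ]; exact measure_closedBall_lt_top⟩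
    refine MemLp.of_bound (C := 1) ?_ (Eventually.of_forall fun ξ => ?_)
    · refine Continuous.aestronglyMeasurable ?_
      have h := Real.continuous_fourierChar
      fun_prop
    · rw [RCLike.norm_conj, Circle.norm_coe]
  refine ⟨hmem.toLp _, fun z => ?_⟩
  rw [Real.fourierInv_eq, L2.inner_def]
  refine integral_congr_ae ?_
  filter_upwards [hmem.coeFn_toLp, coeFn_cutoff measurableSet_closedBall z] with ξ h1 h2
  rw [h1, h2]
  by_cases hξ : ξ ∈ Metric.closedBall (0 : Space N) K
  · rw [Set.indicator_of_mem hξ, Set.indicator_of_mem hξ, Circle.smul_def, smul_eq_mul,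
      RCLike.inner_apply, Complex.conj_conj, mul_comm]
  · simp [Set.indicator_of_notMem hξ]

/-- Localization in a ball and in a frequency ball is a compact operation. -/
theorem tendsto_cutoff_fourierInv_cutoff (K ρ : ℝ) {z : ℕ → L2 N} {R : ℝ} (hR : ∀ n, ‖z n‖ ≤ R)
    (hz : ∀ g : L2 N, Tendsto (fun n => ⟪g, z n⟫_ℂ) atTop (𝓝 0)) :
    Tendsto (fun n => cutoff (Metric.closedBall 0 ρ) measurableSet_closedBall
      (𝓕⁻ (cutoff (Metric.closedBall 0 K) measurableSet_closedBall (z n)))) atTop (𝓝 0) := by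
  set F : ℕ → Space N → ℂ := fun n =>
    𝓕⁻ (cutoff (Metric.closedBall 0 K) measurableSet_closedBall (z n) : Space N → ℂ) with hF
  have hFmeas : ∀ n, AEStronglyMeasurable (F n) volume := fun n =>
    (Lp.aestronglyMeasurable _).congr
      (coeFn_fourierInv_of_integrable _ (integrable_cutoff_closedBall K (z n)))
  have hFlim : ∀ x, Tendsto (fun n => F n x) atTop (𝓝 0) := fun x => by
    obtain ⟨e, he⟩ := exists_fourierInv_cutoff_eq_inner K x
    exact (hz e).congr fun n => (he _).symm
  -- A bound uniform in `x` and `n` is an integrable majorant on the ball of radius `ρ`, so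
  -- dominated convergence applies.
  have hFbound : ∀ n x, ‖F n x‖ₑ ^ 2
      ≤ volume (Metric.closedBall (0 : Space N) K) * ENNReal.ofReal (R ^ 2) := fun n x => by
    calc ‖F n x‖ₑ ^ 2 ≤ (∫⁻ ξ in Metric.closedBall 0 K, 1 * ‖z n ξ‖ₑ) ^ 2 := by
          simp_rw [one_mul]
          exact pow_le_pow_left' (enorm_fourierInv_cutoff_le K (z n) x) 2
      _ ≤ _ := lintegral_mul_sq_le (by fun_prop) (Lp.aestronglyMeasurable (z n)).enorm.restrict
      _ ≤ _ := by
          refine mul_le_mul' (by simp) ((setLIntegral_le_lintegral _ _).trans ?_)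
          rw [lintegral_enorm_sq]
          exact ENNReal.ofReal_le_ofReal (pow_le_pow_left₀ (norm_nonneg _) (hR n) 2)
  have hint : Tendsto (fun n => ∫⁻ x in Metric.closedBall 0 ρ, ‖F n x‖ₑ ^ 2) atTop (𝓝 0) := by
    have h := tendsto_lintegral_of_dominated_convergence'
      (μ := volume.restrict (Metric.closedBall (0 : Space N) ρ))
      (F := fun n x => ‖F n x‖ₑ ^ 2) (f := fun _ => 0)
      (fun _ => volume (Metric.closedBall (0 : Space N) K) * ENNReal.ofReal (R ^ 2))
      (fun n => ((hFmeas n).enorm.pow_const 2).restrict)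
      (fun n => Eventually.of_forall (hFbound n)) ?_ (Eventually.of_forall fun x => ?_)
    · simpa using h
    · rw [setLIntegral_const]
      exact ENNReal.mul_ne_top (ENNReal.mul_ne_top measure_closedBall_lt_top.ne
        ENNReal.ofReal_ne_top) measure_closedBall_lt_top.ne
    · have h1 := ((continuous_enorm.tendsto (0 : ℂ)).comp (hFlim x))
      have h2 := ((ENNReal.continuous_pow 2).tendsto _).comp h1
      simpa [Function.comp_def] using h2
  rw [tendsto_zero_iff_norm_tendsto_zero]
  have heq : ∀ n, ∫⁻ x in Metric.closedBall 0 ρ, ‖F n x‖ₑ ^ 2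
      = ENNReal.ofReal (‖cutoff (Metric.closedBall 0 ρ) measurableSet_closedBall
      (𝓕⁻ (cutoff (Metric.closedBall 0 K) measurableSet_closedBall (z n)))‖ ^ 2) := fun n => by
    rw [← lintegral_enorm_sq, ← lintegral_indicator measurableSet_closedBall]
    refine lintegral_congr_ae ?_
    filter_upwards [coeFn_cutoff (measurableSet_closedBall (x := (0 : Space N)) (ε := ρ))
      (𝓕⁻ (cutoff (Metric.closedBall 0 K) measurableSet_closedBall (z n))),
      coeFn_fourierInv_of_integrable _ (integrable_cutoff_closedBall K (z n))] with x h1 h2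
    rw [h1]
    by_cases hx : x ∈ Metric.closedBall (0 : Space N) ρ
    · rw [Set.indicator_of_mem hx, Set.indicator_of_mem hx, h2]
    · simp [Set.indicator_of_notMem hx]
  simp_rw [heq] at hint
  have h1 := (ENNReal.tendsto_toReal ENNReal.zero_ne_top).comp hint
  have h2 : Tendsto (fun n => ‖cutoff (Metric.closedBall 0 ρ) measurableSet_closedBall
      (𝓕⁻ (cutoff (Metric.closedBall 0 K) measurableSet_closedBall (z n)))‖ ^ 2) atTop (𝓝 0) := by
    refine h1.congr fun n => ?_
    exact ENNReal.toReal_ofReal (sq_nonneg _)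
  have h3 := (Real.continuous_sqrt.tendsto _).comp h2
  rw [Real.sqrt_zero] at h3
  exact h3.congr fun n => Real.sqrt_sq (norm_nonneg _)

variable {V : Space N → ℝ} {hV : IsConfining V} {m s : ℝ}

theorem rpow_norm_le_symbol (hs : 0 ≤ s) (ξ : Space N) : ‖ξ‖ ^ s ≤ symbol m (s / 2) ξ := by
  have h1 : ‖ξ‖ ^ s = (‖ξ‖ ^ 2) ^ (s / 2) := by
    rw [← Real.rpow_natCast_mul (norm_nonneg _)]
    congr 1
    push_cast
    ring
  rw [h1, symbol]
  refine Real.rpow_le_rpow (by positivity) ?_ (by positivity)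
  have h2 : 1 ≤ 2 * Real.pi := by linarith [Real.pi_gt_three]
  have h3 : ‖ξ‖ ≤ 2 * Real.pi * ‖ξ‖ := le_mul_of_one_le_left (norm_nonneg _) h2
  have h4 := pow_le_pow_left₀ (norm_nonneg _) h3 2
  linarith [sq_nonneg m]

theorem norm_kin_le (v : EnergySpace hV m s) : ‖kin v‖ ≤ ‖v‖ := by
  have := norm_sq_eq v
  exact pow_le_pow_iff_left₀ (norm_nonneg _) (norm_nonneg _) two_ne_zero |>.1
    (by linarith [sq_nonneg ‖pot v‖])

theorem norm_pot_le (v : EnergySpace hV m s) : ‖pot v‖ ≤ ‖v‖ := by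
  have := norm_sq_eq v
  exact pow_le_pow_iff_left₀ (norm_nonneg _) (norm_nonneg _) two_ne_zero |>.1
    (by linarith [sq_nonneg ‖kin v‖])

theorem coeFn_pot (v : EnergySpace hV m s) :
    pot v =ᵐ[volume] fun x => (√(V x) : ℂ) * toL2 v x :=
  v.memPotDomain.coeFn_toLp

theorem coeFn_fourier_kin (v : EnergySpace hV m s) :
    (𝓕 (kin v) : L2 N) =ᵐ[volume] fun ξ => (symbol m (s / 2) ξ : ℂ) * (𝓕 (toL2 v) : L2 N) ξ := by
  have h : 𝓕 (kin v) = v.memFracDomain.toLp _ := FourierTransform.fourier_fourierInv_eq _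
  rw [h]
  exact v.memFracDomain.coeFn_toLp

theorem rpow_norm_mul_le_fourier_kin (hs : 0 ≤ s) (v : EnergySpace hV m s) :
    ∀ᵐ ξ, ‖ξ‖ ^ s * ‖(𝓕 (toL2 v) : L2 N) ξ‖ ≤ ‖(𝓕 (kin v) : L2 N) ξ‖ := by
  filter_upwards [coeFn_fourier_kin v] with ξ h
  have h1 := rpow_norm_le_symbol (m := m) hs ξ
  have h2 : 0 ≤ ‖ξ‖ ^ s := by positivity
  rw [h, norm_mul, Complex.norm_real, Real.norm_of_nonneg (h2.trans h1)]
  gcongr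

/-- Elements of `Σ^s` are localized in phase space, uniformly on bounded sets. -/
theorem exists_norm_sub_cutoff_lt (hV : IsConfining V) (m : ℝ) (hs : 0 < s) (R : ℝ) {ε : ℝ}
    (hε : 0 < ε) :
    ∃ K ρ : ℝ, ∀ v : EnergySpace hV m s, ‖v‖ ≤ R →
      ‖toL2 v - cutoff (Metric.closedBall 0 ρ) measurableSet_closedBall
        (𝓕⁻ (cutoff (Metric.closedBall 0 K) measurableSet_closedBall (𝓕 (toL2 v))))‖ < ε := by
  -- From `A t ≤ |R|` follows `t < ε / 2`. Outside the chosen balls both `√V` and `‖ξ‖^s` are at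
  -- least `A`.
  set A := (2 * |R| + 1) / ε with hA
  have hApos : 0 < A := by positivity
  obtain ⟨ρ, hρ⟩ : ∃ ρ : ℝ, ∀ x, x ∉ Metric.closedBall 0 ρ → A ^ 2 ≤ V x := by
    have h := hV.tendsto_atTop.eventually_ge_atTop (A ^ 2)
    rw [← Metric.cobounded_eq_cocompact, ← Metric.comap_dist_left_atTop (0 : Space N),
      Filter.eventually_comap, Filter.eventually_atTop] at h
    obtain ⟨ρ, hρ⟩ := h
    refine ⟨ρ, fun x hx => ?_⟩
    rw [Metric.mem_closedBall', not_le] at hx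
    exact hρ _ hx.le x rfl
  set K := A ^ s⁻¹ with hK
  have hKs : K ^ s = A := Real.rpow_inv_rpow hApos.le hs.ne'
  refine ⟨K, ρ, fun v hv => ?_⟩
  have hkey : ∀ t : ℝ, A * t ≤ ‖v‖ → t < ε / 2 := fun t ht => by
    have h1 : A * t ≤ |R| := ht.trans (hv.trans (le_abs_self R))
    rw [hA, div_mul_eq_mul_div, div_le_iff₀ hε] at h1
    by_contra! hcon
    nlinarith [abs_nonneg R]
  have h1 : ‖toL2 v - cutoff (Metric.closedBall 0 ρ) measurableSet_closedBall (toL2 v)‖ < ε / 2 := by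
    refine hkey _ (le_trans (mul_norm_sub_cutoff_le _ hApos.le ?_) (norm_pot_le v))
    filter_upwards [coeFn_pot v] with x hx hxρ
    rw [hx, norm_mul, Complex.norm_real, Real.norm_of_nonneg (Real.sqrt_nonneg _)]
    gcongr
    exact Real.le_sqrt_of_sq_le (hρ x hxρ)
  have h2 : ‖𝓕 (toL2 v) - cutoff (Metric.closedBall 0 K) measurableSet_closedBall (𝓕 (toL2 v))‖
      < ε / 2 := by
    refine hkey _ (le_trans (mul_norm_sub_cutoff_le (g := 𝓕 (kin v)) _ hApos.le ?_) ?_)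
    · filter_upwards [rpow_norm_mul_le_fourier_kin hs.le v] with ξ hξ hξK
      refine le_trans ?_ hξ
      rw [mem_closedBall_zero_iff, not_le] at hξK
      rw [← hKs]
      have : 0 ≤ K := by positivity
      gcongr
    · rw [Lp.norm_fourier_eq]
      exact norm_kin_le v
  -- The error splits into the spatial tail and the spatial cutoff of the frequency tail; the cutoff
  -- is a contraction.
  have h3 : toL2 v - cutoff (Metric.closedBall 0 ρ) measurableSet_closedBall
        (𝓕⁻ (cutoff (Metric.closedBall 0 K) measurableSet_closedBall (𝓕 (toL2 v))))
      = (toL2 v - cutoff (Metric.closedBall 0 ρ) measurableSet_closedBall (toL2 v))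
        + cutoff (Metric.closedBall 0 ρ) measurableSet_closedBall ((Lp.fourierTransformₗᵢ _ _).symm
          (𝓕 (toL2 v) - cutoff (Metric.closedBall 0 K) measurableSet_closedBall (𝓕 (toL2 v)))) := by
    rw [map_sub (Lp.fourierTransformₗᵢ _ _).symm, map_sub]
    have h4 : (Lp.fourierTransformₗᵢ (Space N) ℂ).symm (𝓕 (toL2 v)) = toL2 v :=
      (Lp.fourierTransformₗᵢ (Space N) ℂ).symm_apply_apply _
    rw [h4]
    exact (sub_add_sub_cancel _ _ _).symm
  rw [h3]
  refine (norm_add_le _ _).trans_lt ?_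
  have h5 := norm_cutoff_le (measurableSet_closedBall (x := (0 : Space N)) (ε := ρ))
    ((Lp.fourierTransformₗᵢ _ _).symm
      (𝓕 (toL2 v) - cutoff (Metric.closedBall 0 K) measurableSet_closedBall (𝓕 (toL2 v))))
  rw [LinearIsometryEquiv.norm_map] at h5
  linarith

/-- The embedding of `Σ^s` into `L²` is compact. -/
theorem exists_subseq_cauchySeq_toL2 (hs : 0 < s) (u : ℕ → EnergySpace hV m s) (R : ℝ)
    (hR : ∀ n, ‖u n‖ ≤ R) :
    ∃ φ : ℕ → ℕ, StrictMono φ ∧ CauchySeq (fun n => toL2L (u (φ n))) := by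
  set w : ℕ → L2 N := fun n => 𝓕 (toL2 (u n)) with hw
  have hwR : ∀ n, ‖w n‖ ≤ ‖toL2L (hV := hV) (m := m) (s := s)‖ * R := fun n => by
    rw [hw, Lp.norm_fourier_eq]
    exact (toL2L.le_opNorm (u n)).trans (by gcongr; exact hR n)
  -- Needed for the instance that makes `L²` separable.
  have : Fact ((2 : ℝ≥0∞) ≠ ⊤) := ⟨by norm_num⟩
  obtain ⟨z, φ, hφ, hz⟩ := exists_subseq_tendsto_inner hwR
  refine ⟨φ, hφ, cauchySeq_of_forall_approx fun ε hε => ?_⟩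
  obtain ⟨K, ρ, hKρ⟩ := exists_norm_sub_cutoff_lt hV m hs R hε
  refine ⟨fun n => cutoff (Metric.closedBall 0 ρ) measurableSet_closedBall
    (𝓕⁻ (cutoff (Metric.closedBall 0 K) measurableSet_closedBall (w (φ n)))), ?_,
    fun n => hKρ _ (hR _)⟩
  have h1 := tendsto_cutoff_fourierInv_cutoff K ρ (z := fun n => w (φ n) - z)
    (R := ‖toL2L (hV := hV) (m := m) (s := s)‖ * R + ‖z‖)
    (fun n => (norm_sub_le _ _).trans (by gcongr; exact hwR _)) fun g => by
      simp_rw [inner_sub_right]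
      simpa using (hz g).sub_const ⟪g, z⟫_ℂ
  have h2 := h1.add_const (cutoff (Metric.closedBall 0 ρ) measurableSet_closedBall
    ((Lp.fourierTransformₗᵢ _ _).symm
      (cutoff (Metric.closedBall 0 K) measurableSet_closedBall z)))
  refine (h2.congr fun n => ?_).cauchySeq
  rw [← map_add, map_sub]
  congr 1
  exact (map_add (Lp.fourierTransformₗᵢ (Space N) ℂ).symm _ _).symm.trans
    (by rw [sub_add_cancel]; rfl)

end OrbitalStability

end

/-! ### Completeness of the energy space. -/

noncomputable section

namespace OrbitalStability

open FracHartree FracHartree.EnergySpace Filter Topology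

variable {N : ℕ}

/-- Multiplication operators on `L²` are closed. -/
theorem coeFn_eq_mul_of_tendsto {g : Space N → ℂ} {f h : ℕ → L2 N} {f₀ h₀ : L2 N}
    (hf : Tendsto f atTop (𝓝 f₀)) (hh : Tendsto h atTop (𝓝 h₀))
    (hfh : ∀ n, h n =ᵐ[volume] fun x => g x * f n x) :
    h₀ =ᵐ[volume] fun x => g x * f₀ x := by
  obtain ⟨φ, hφ, h1⟩ := (tendstoInMeasure_of_tendsto_Lp hf).exists_seq_tendsto_ae
  obtain ⟨ψ, hψ, h2⟩ :=
    (tendstoInMeasure_of_tendsto_Lp (hh.comp hφ.tendsto_atTop)).exists_seq_tendsto_ae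
  filter_upwards [h1, h2, ae_all_iff.2 hfh] with x hx1 hx2 hx3
  refine tendsto_nhds_unique hx2 ?_
  refine ((hx1.comp hψ.tendsto_atTop).const_mul (g x)).congr fun n => ?_
  exact (hx3 _).symm

variable {V : Space N → ℝ} {hV : IsConfining V} {m s : ℝ}

/-- The energy norm is the graph norm of two multiplication operators, one after the Fourier
transform. Since these are closed, the `L²` limits of `kin` and `pot` are those of the limit
function. -/
instance completeSpace_energySpace : CompleteSpace (EnergySpace hV m s) := by
  refine Metric.complete_of_cauchySeq_tendsto fun u hu => ?_
  have hcauchy : ∀ L : EnergySpace hV m s →ₗ[ℂ] L2 N, (∃ C, ∀ v, ‖L v‖ ≤ C * ‖v‖) →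
      ∃ a, Tendsto (fun n => L (u n)) atTop (𝓝 a) := fun L hL =>
    cauchySeq_tendsto_of_complete
      (hu.map (L.mkContinuousOfExistsBound hL).uniformContinuous)
  obtain ⟨v, hv⟩ := hcauchy toL2 exists_bound_toL2
  obtain ⟨a, ha⟩ := hcauchy kin ⟨1, fun w => by rw [one_mul]; exact norm_kin_le w⟩
  obtain ⟨b, hb⟩ := hcauchy pot ⟨1, fun w => by rw [one_mul]; exact norm_pot_le w⟩
  have hF := (Lp.fourierTransformₗᵢ (Space N) ℂ).continuous
  have hb' := coeFn_eq_mul_of_tendsto hv hb fun n => coeFn_pot (u n)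
  have ha' := coeFn_eq_mul_of_tendsto ((hF.tendsto v).comp hv) ((hF.tendsto a).comp ha)
    fun n => coeFn_fourier_kin (u n)
  let w : EnergySpace hV m s := ⟨v, (Lp.memLp _).ae_eq ha', (Lp.memLp _).ae_eq hb'⟩
  have hwb : pot w = b := Lp.ext ((coeFn_pot w).trans hb'.symm)
  have hwa : kin w = a := by
    apply (Lp.fourierTransformₗᵢ (Space N) ℂ).injective
    exact Lp.ext ((coeFn_fourier_kin w).trans ha'.symm)
  refine ⟨w, ?_⟩
  rw [tendsto_iff_norm_sub_tendsto_zero] at ha hb ⊢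
  have h1 := ((ha.pow 2).add (hb.pow 2)).sqrt
  norm_num at h1
  refine h1.congr fun n => ?_
  rw [← hwa, ← hwb, ← map_sub, ← map_sub, ← norm_sq_eq, Real.sqrt_sq (norm_nonneg _)]

end OrbitalStability

end

/-! ### Subcriticality of the Hartree energy. -/

noncomputable section

namespace OrbitalStability

open FracHartree FracHartree.EnergySpace Filter Topology

variable {N : ℕ} {V : Space N → ℝ} {hV : IsConfining V} {m s γ : ℝ}

/-- Inside the ball of radius `ρ` the Morrey estimate feeds the Riesz bound for the measure `|v|²
dy`; outside, the kernel is at most `ρ^{-γ}`. The free radius `ρ` later makes the coefficient of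
`‖v‖²` small. -/
theorem lintegral_hartree_le (hs : 0 < s) (hsN : 2 * s < N) (hγ : 0 < γ) (hγs : γ < 2 * s)
    (v : EnergySpace hV m s) (x : Space N) {ρ : ℝ} (hρ : 0 < ρ) :
    ∫⁻ y, ENNReal.ofReal (‖toL2 v y‖ ^ 2 / ‖x - y‖ ^ γ)
      ≤ ENNReal.ofReal (rieszConst (2 * s) γ * morreyConst N s * ρ ^ (2 * s - γ) * ‖v‖ ^ 2
        + (1 / ρ ^ γ) * ‖toL2 v‖ ^ 2) := by
  have hrc := rieszConst_nonneg hγs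
  have hmc := morreyConst_nonneg hsN
  have hmeas : Measurable fun y => ‖toL2 v y‖ₑ ^ 2 :=
    (Lp.stronglyMeasurable (toL2 v)).measurable.enorm.pow_const 2
  have hfac : ∀ y, ENNReal.ofReal (‖toL2 v y‖ ^ 2 / ‖x - y‖ ^ γ)
      = ‖toL2 v y‖ₑ ^ 2 * ENNReal.ofReal (1 / ‖x - y‖ ^ γ) := fun y => by
    rw [div_eq_mul_one_div, ENNReal.ofReal_mul (by positivity), ENNReal.ofReal_pow (norm_nonneg _),
      ofReal_norm]
  have hin : ∫⁻ y in Metric.closedBall x ρ, ‖toL2 v y‖ₑ ^ 2 * ENNReal.ofReal (1 / ‖x - y‖ ^ γ)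
      ≤ ENNReal.ofReal (rieszConst (2 * s) γ * morreyConst N s * ρ ^ (2 * s - γ) * ‖v‖ ^ 2) := by
    have h1 := lintegral_closedBall_inv_rpow_le
      (volume.withDensity fun y => ‖toL2 v y‖ₑ ^ 2) x hγ hγs
      (A := morreyConst N s * ‖v‖ ^ 2) (by positivity) hρ fun r hr _ => by
        rw [withDensity_apply _ measurableSet_closedBall]
        refine (lintegral_closedBall_enorm_sq_le hs hsN
          (rpow_norm_mul_le_fourier_kin hs.le v) x hr).trans (ENNReal.ofReal_le_ofReal ?_)
        rw [Lp.norm_fourier_eq]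
        gcongr
        exact norm_kin_le v
    rw [setLIntegral_withDensity_eq_setLIntegral_mul _ hmeas (by fun_prop)
      measurableSet_closedBall] at h1
    refine h1.trans (ENNReal.ofReal_le_ofReal (le_of_eq ?_))
    ring
  have hout : ∫⁻ y in (Metric.closedBall x ρ)ᶜ, ‖toL2 v y‖ₑ ^ 2 * ENNReal.ofReal (1 / ‖x - y‖ ^ γ)
      ≤ ENNReal.ofReal ((1 / ρ ^ γ) * ‖toL2 v‖ ^ 2) := by
    calc _ ≤ ∫⁻ y in (Metric.closedBall x ρ)ᶜ, ‖toL2 v y‖ₑ ^ 2 * ENNReal.ofReal (1 / ρ ^ γ) := by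
          refine setLIntegral_mono' measurableSet_closedBall.compl fun y hy => ?_
          have : ρ ≤ ‖x - y‖ := by
            rw [Set.mem_compl_iff, Metric.mem_closedBall', not_le, dist_eq_norm] at hy
            exact hy.le
          gcongr
      _ ≤ ∫⁻ y, ‖toL2 v y‖ₑ ^ 2 * ENNReal.ofReal (1 / ρ ^ γ) := setLIntegral_le_lintegral _ _
      _ = _ := by
          rw [lintegral_mul_const _ hmeas, lintegral_enorm_sq, mul_comm,
            ← ENNReal.ofReal_mul (by positivity)]
  simp_rw [hfac]
  rw [← lintegral_add_compl _ (measurableSet_closedBall (x := x) (ε := ρ)),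
    ENNReal.ofReal_add (by positivity) (by positivity)]
  exact add_le_add hin hout

theorem stronglyMeasurable_hartree (γ : ℝ) (v : EnergySpace hV m s) :
    StronglyMeasurable fun p : Space N × Space N => ‖toL2 v p.2‖ ^ 2 / ‖p.1 - p.2‖ ^ γ := by
  have h : Measurable (toL2 v) := (Lp.stronglyMeasurable (toL2 v)).measurable
  refine Measurable.stronglyMeasurable ?_
  fun_prop

theorem integrable_hartree (hs : 0 < s) (hsN : 2 * s < N) (hγ : 0 < γ) (hγs : γ < 2 * s)
    (v : EnergySpace hV m s) (x : Space N) :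
    Integrable fun y => ‖toL2 v y‖ ^ 2 / ‖x - y‖ ^ γ := by
  refine ⟨((stronglyMeasurable_hartree γ v).comp_measurable
    measurable_prodMk_left).aestronglyMeasurable, ?_⟩
  rw [hasFiniteIntegral_iff_ofReal (Eventually.of_forall fun y => by positivity)]
  exact (lintegral_hartree_le hs hsN hγ hγs v x one_pos).trans_lt ENNReal.ofReal_lt_top

theorem hartreePotential_nonneg (v : EnergySpace hV m s) (x : Space N) :
    0 ≤ hartreePotential γ v x :=
  integral_nonneg fun y => by positivity

theorem measurable_hartreePotential (v : EnergySpace hV m s) :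
    StronglyMeasurable (hartreePotential γ v) :=
  (stronglyMeasurable_hartree γ v).integral_prod_right

/-- `|x|^{-γ}` is form bounded by `(-Δ + m²)^s` with relative bound zero, uniformly with respect to
translations. -/
theorem exists_hartreePotential_le (hV : IsConfining V) (m : ℝ) (hs : 0 < s) (hsN : 2 * s < N)
    (hγ : 0 < γ) (hγs : γ < 2 * s) {η : ℝ} (hη : 0 < η) :
    ∃ C : ℝ, 0 ≤ C ∧ ∀ (v : EnergySpace hV m s) (x : Space N),
      hartreePotential γ v x ≤ η * ‖v‖ ^ 2 + C * ‖toL2 v‖ ^ 2 := by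
  set B := rieszConst (2 * s) γ * morreyConst N s with hB
  have hB0 : 0 ≤ B := mul_nonneg (rieszConst_nonneg hγs) (morreyConst_nonneg hsN)
  -- Then `B ρ^{2s-γ} = B η / (B + 1) ≤ η`; the `+ 1` covers `B = 0`.
  set ρ := (η / (B + 1)) ^ (2 * s - γ)⁻¹ with hρ
  have hρpos : 0 < ρ := by positivity
  have hρη : B * ρ ^ (2 * s - γ) ≤ η := by
    rw [hρ, Real.rpow_inv_rpow (by positivity) (sub_pos.2 hγs).ne', mul_div_assoc',
      div_le_iff₀ (by positivity)]
    nlinarith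
  refine ⟨1 / ρ ^ γ, by positivity, fun v x => ?_⟩
  have h1 := lintegral_hartree_le hs hsN hγ hγs v x hρpos
  rw [← ofReal_integral_eq_lintegral_ofReal (integrable_hartree hs hsN hγ hγs v x)
    (Eventually.of_forall fun y => by positivity), ENNReal.ofReal_le_ofReal_iff (by positivity)]
    at h1
  refine h1.trans ?_
  gcongr

/-- Young's inequality in place of Cauchy–Schwarz: the right-hand side is a combination of squares.
A difference of densities is thus controlled by the densities of `u - v`, `u` and `v`, to which the
bounds on Hartree potentials apply directly. -/
theorem abs_sq_sub_sq_le {a b c θ : ℝ} (h : |a - b| ≤ c) (ha : 0 ≤ a)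
    (hb : 0 ≤ b) (hθ : 0 < θ) : |a ^ 2 - b ^ 2| ≤ (1 / (2 * θ)) * c ^ 2 + θ * (a ^ 2 + b ^ 2) := by
  have h1 : |a ^ 2 - b ^ 2| ≤ c * (a + b) := by
    rw [sq_sub_sq, abs_mul, abs_of_nonneg (add_nonneg ha hb), mul_comm]
    gcongr
  have h2 : c * (a + b) ≤ (1 / (2 * θ)) * c ^ 2 + θ / 2 * (a + b) ^ 2 := by
    have h3 : (1 / (2 * θ)) * c ^ 2 + θ / 2 * (a + b) ^ 2 - c * (a + b)
        = (c - θ * (a + b)) ^ 2 / (2 * θ) := by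
      field_simp
      ring
    have : 0 ≤ (c - θ * (a + b)) ^ 2 / (2 * θ) := by positivity
    linarith
  nlinarith [mul_nonneg hθ.le (sq_nonneg (a - b))]

theorem abs_norm_sq_sub_le (u v : EnergySpace hV m s) {θ : ℝ} (hθ : 0 < θ) :
    ∀ᵐ y, |‖toL2 u y‖ ^ 2 - ‖toL2 v y‖ ^ 2|
      ≤ (1 / (2 * θ)) * ‖toL2 (u - v) y‖ ^ 2 + θ * (‖toL2 u y‖ ^ 2 + ‖toL2 v y‖ ^ 2) := by
  filter_upwards [Lp.coeFn_sub (toL2 u) (toL2 v)] with y hy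
  rw [map_sub, hy, Pi.sub_apply]
  exact abs_sq_sub_sq_le (abs_norm_sub_norm_le _ _) (norm_nonneg _)
    (norm_nonneg _) hθ

theorem integrable_norm_sq (v : EnergySpace hV m s) : Integrable fun x => ‖toL2 v x‖ ^ 2 :=
  (Lp.memLp (toL2 v)).integrable_norm_pow (by norm_num)

theorem mass_eq (v : EnergySpace hV m s) : mass v = ‖toL2 v‖ ^ 2 := by
  have h := lintegral_enorm_sq (toL2 v)
  have h1 : ∀ x, ‖toL2 v x‖ₑ ^ 2 = ENNReal.ofReal (‖toL2 v x‖ ^ 2) := fun x => by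
    rw [ENNReal.ofReal_pow (norm_nonneg _), ofReal_norm]
  simp_rw [h1] at h
  rw [← ofReal_integral_eq_lintegral_ofReal (integrable_norm_sq v)
    (Eventually.of_forall fun y => by positivity),
    ENNReal.ofReal_eq_ofReal_iff (integral_nonneg fun _ => by positivity) (by positivity)] at h
  exact h

theorem abs_hartreePotential_sub_le (hs : 0 < s) (hsN : 2 * s < N) (hγ : 0 < γ)
    (hγs : γ < 2 * s) (u v : EnergySpace hV m s) {θ : ℝ} (hθ : 0 < θ) (x : Space N) :
    |hartreePotential γ u x - hartreePotential γ v x|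
      ≤ (1 / (2 * θ)) * hartreePotential γ (u - v) x
        + θ * (hartreePotential γ u x + hartreePotential γ v x) := by
  have hi := integrable_hartree (hV := hV) (m := m) hs hsN hγ hγs
  have h1 : Integrable fun y => 1 / (2 * θ) * (‖toL2 (u - v) y‖ ^ 2 / ‖x - y‖ ^ γ) :=
    (hi (u - v) x).const_mul _
  have h2 : Integrable fun y =>
      θ * (‖toL2 u y‖ ^ 2 / ‖x - y‖ ^ γ + ‖toL2 v y‖ ^ 2 / ‖x - y‖ ^ γ) :=
    ((hi u x).add (hi v x)).const_mul _
  unfold hartreePotential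
  rw [← integral_sub (hi u x) (hi v x), ← integral_add (hi u x) (hi v x),
    ← integral_const_mul, ← integral_const_mul, ← integral_add h1 h2]
  refine (abs_integral_le_integral_abs).trans (integral_mono_ae ((hi u x).sub (hi v x)).abs
    (h1.add h2) ?_)
  filter_upwards [abs_norm_sq_sub_le u v hθ] with y hy
  have h0 : 0 ≤ ‖x - y‖ ^ γ := by positivity
  rw [← sub_div, abs_div, abs_of_nonneg h0, ← add_div, mul_div_assoc', mul_div_assoc', ← add_div]
  gcongr

/-- The quartic part `∬ |v(x)|² |v(y)|² / |x - y|^γ` of the energy. -/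
def hartreeEnergy (γ : ℝ) (v : EnergySpace hV m s) : ℝ :=
  ∫ x, hartreePotential γ v x * ‖toL2 v x‖ ^ 2

theorem integrable_hartreePotential_mul (hs : 0 < s) (hsN : 2 * s < N) (hγ : 0 < γ)
    (hγs : γ < 2 * s) (u : EnergySpace hV m s) {f : Space N → ℝ} (hf : Integrable f) :
    Integrable fun x => hartreePotential γ u x * f x := by
  obtain ⟨C, -, hC⟩ := exists_hartreePotential_le hV m hs hsN hγ hγs one_pos
  refine hf.bdd_mul (c := 1 * ‖u‖ ^ 2 + C * ‖toL2 u‖ ^ 2)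
    (measurable_hartreePotential u).aestronglyMeasurable (Eventually.of_forall fun x => ?_)
  rw [Real.norm_of_nonneg (hartreePotential_nonneg u x)]
  exact hC u x

theorem hartreePotential_smul (c : ℝ) (v : EnergySpace hV m s) (x : Space N) :
    hartreePotential γ ((c : ℂ) • v) x = c ^ 2 * hartreePotential γ v x := by
  unfold hartreePotential
  rw [← integral_const_mul]
  refine integral_congr_ae ?_
  filter_upwards [Lp.coeFn_smul (c : ℂ) (toL2 v)] with y hy
  rw [map_smul, hy, Pi.smul_apply, norm_smul, mul_pow, Complex.norm_real, Real.norm_eq_abs, sq_abs,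
    mul_div_assoc]

theorem hartreeEnergy_smul (c : ℝ) (v : EnergySpace hV m s) :
    hartreeEnergy γ ((c : ℂ) • v) = c ^ 4 * hartreeEnergy γ v := by
  unfold hartreeEnergy
  rw [← integral_const_mul]
  refine integral_congr_ae ?_
  filter_upwards [Lp.coeFn_smul (c : ℂ) (toL2 v)] with y hy
  rw [hartreePotential_smul, map_smul, hy, Pi.smul_apply, norm_smul, mul_pow, Complex.norm_real,
    Real.norm_eq_abs, sq_abs]
  ring

theorem abs_hartreePotential_mul_sub_le (hs : 0 < s) (hsN : 2 * s < N) (hγ : 0 < γ)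
    (hγs : γ < 2 * s) (u v : EnergySpace hV m s) {θ : ℝ} (hθ : 0 < θ) {B b : ℝ}
    (hu : ∀ x, hartreePotential γ u x ≤ B) (hv : ∀ x, hartreePotential γ v x ≤ B)
    (huv : ∀ x, hartreePotential γ (u - v) x ≤ b) :
    ∀ᵐ x, |hartreePotential γ u x * ‖toL2 u x‖ ^ 2 - hartreePotential γ v x * ‖toL2 v x‖ ^ 2|
      ≤ ((1 / (2 * θ)) * b + θ * (B + B)) * ‖toL2 u x‖ ^ 2
        + B * ((1 / (2 * θ)) * ‖toL2 (u - v) x‖ ^ 2 + θ * (‖toL2 u x‖ ^ 2 + ‖toL2 v x‖ ^ 2)) := by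
  have hB : 0 ≤ B := (hartreePotential_nonneg u 0).trans (hu 0)
  filter_upwards [abs_norm_sq_sub_le u v hθ] with x hx
  have h1 := abs_hartreePotential_sub_le hs hsN hγ hγs u v hθ x
  have h2 : |hartreePotential γ u x - hartreePotential γ v x|
      ≤ (1 / (2 * θ)) * b + θ * (B + B) := by
    refine h1.trans ?_
    gcongr
    exacts [huv x, hu x, hv x]
  have h3 := hartreePotential_nonneg (γ := γ) v x
  have h4 : hartreePotential γ u x * ‖toL2 u x‖ ^ 2 - hartreePotential γ v x * ‖toL2 v x‖ ^ 2
      = (hartreePotential γ u x - hartreePotential γ v x) * ‖toL2 u x‖ ^ 2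
        + hartreePotential γ v x * (‖toL2 u x‖ ^ 2 - ‖toL2 v x‖ ^ 2) := by ring
  rw [h4]
  refine (abs_add_le _ _).trans ?_
  rw [abs_mul, abs_mul, abs_of_nonneg h3, abs_of_nonneg (sq_nonneg ‖toL2 u x‖)]
  exact add_le_add (mul_le_mul_of_nonneg_right h2 (sq_nonneg _))
    (mul_le_mul (hv x) hx (abs_nonneg _) hB)

theorem abs_hartreeEnergy_sub_le (hs : 0 < s) (hsN : 2 * s < N) (hγ : 0 < γ)
    (hγs : γ < 2 * s) (u v : EnergySpace hV m s) {θ : ℝ} (hθ : 0 < θ) {B b : ℝ}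
    (hu : ∀ x, hartreePotential γ u x ≤ B) (hv : ∀ x, hartreePotential γ v x ≤ B)
    (huv : ∀ x, hartreePotential γ (u - v) x ≤ b) :
    |hartreeEnergy γ u - hartreeEnergy γ v|
      ≤ ((1 / (2 * θ)) * b + θ * (B + B)) * ‖toL2 u‖ ^ 2
        + B * ((1 / (2 * θ)) * ‖toL2 (u - v)‖ ^ 2 + θ * (‖toL2 u‖ ^ 2 + ‖toL2 v‖ ^ 2)) := by
  have hiu := integrable_norm_sq u
  have hiv := integrable_norm_sq v
  have h1 : Integrable fun x => 1 / (2 * θ) * ‖toL2 (u - v) x‖ ^ 2 :=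
    (integrable_norm_sq (u - v)).const_mul _
  have h2 : Integrable fun x => θ * (‖toL2 u x‖ ^ 2 + ‖toL2 v x‖ ^ 2) :=
    (hiu.add hiv).const_mul _
  have h3 : Integrable fun x => B * (1 / (2 * θ) * ‖toL2 (u - v) x‖ ^ 2
      + θ * (‖toL2 u x‖ ^ 2 + ‖toL2 v x‖ ^ 2)) := (h1.add h2).const_mul _
  have h4 : Integrable fun x => (1 / (2 * θ) * b + θ * (B + B)) * ‖toL2 u x‖ ^ 2 :=
    hiu.const_mul _
  have h5 := integrable_hartreePotential_mul hs hsN hγ hγs u hiu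
  have h6 := integrable_hartreePotential_mul hs hsN hγ hγs v hiv
  have hmono := integral_mono_ae (h5.sub h6).abs (h4.add h3)
    (abs_hartreePotential_mul_sub_le hs hsN hγ hγs u v hθ hu hv huv)
  have habs : |hartreeEnergy γ u - hartreeEnergy γ v| ≤ ∫ x, |hartreePotential γ u x
      * ‖toL2 u x‖ ^ 2 - hartreePotential γ v x * ‖toL2 v x‖ ^ 2| := by
    unfold hartreeEnergy
    rw [← integral_sub h5 h6]
    exact abs_integral_le_integral_abs
  refine (habs.trans hmono).trans_eq ?_
  rw [integral_add' h4 h3, integral_const_mul, integral_const_mul, integral_add h1 h2,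
    integral_const_mul, integral_const_mul, integral_add hiu hiv, ← mass_eq, ← mass_eq, ← mass_eq]
  rfl

theorem hartreeEnergy_nonneg (v : EnergySpace hV m s) : 0 ≤ hartreeEnergy γ v :=
  integral_nonneg fun x => mul_nonneg (hartreePotential_nonneg v x) (sq_nonneg _)

theorem hartreeEnergy_le (hs : 0 < s) (hsN : 2 * s < N) (hγ : 0 < γ)
    (hγs : γ < 2 * s) (v : EnergySpace hV m s) {B : ℝ} (hv : ∀ x, hartreePotential γ v x ≤ B) :
    hartreeEnergy γ v ≤ B * ‖toL2 v‖ ^ 2 := by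
  rw [← mass_eq]
  unfold hartreeEnergy mass
  rw [← integral_const_mul]
  refine integral_mono (integrable_hartreePotential_mul hs hsN hγ hγs v (integrable_norm_sq v))
    ((integrable_norm_sq v).const_mul _) fun x => ?_
  have := hv x
  simp only
  gcongr

/-- The potential of `u - v` is uniformly small when `u - v` is small in `L²` and bounded in `Σ^s`,
because its relative bound `η` is arbitrary. -/
theorem hartreeEnergy_uniform (hV : IsConfining V) (m : ℝ) (hs : 0 < s) (hsN : 2 * s < N)
    (hγ : 0 < γ) (hγs : γ < 2 * s) (R : ℝ) {ε : ℝ} (hε : 0 < ε) :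
    ∃ δ : ℝ, 0 < δ ∧ ∀ u v : EnergySpace hV m s, ‖u‖ ≤ R → ‖v‖ ≤ R → ‖toL2 (u - v)‖ < δ →
      |hartreeEnergy γ u - hartreeEnergy γ v| < ε := by
  set T := ‖toL2L (hV := hV) (m := m) (s := s)‖ with hT
  have hT0 : 0 ≤ T := toL2L.opNorm_nonneg
  obtain ⟨C₁, hC₁0, hC₁⟩ := exists_hartreePotential_le hV m hs hsN hγ hγs one_pos
  set A := 1 + R ^ 2 + (T * R) ^ 2 + (1 * R ^ 2 + C₁ * (T * R) ^ 2) with hA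
  have hA1 : 1 ≤ A := by
    have : 0 ≤ R ^ 2 + (T * R) ^ 2 + (1 * R ^ 2 + C₁ * (T * R) ^ 2) := by positivity
    linarith
  -- The order of choice matters: `θ` for Young's inequality, then `η` depending on `θ`, then `C`
  -- depending on `η`, then `d` bounding the squared `L²` distance. Each of the three error terms
  -- becomes `ε / 4`.
  set θ := ε / (16 * A ^ 2) with hθ
  have hθ0 : 0 < θ := by positivity
  set η := θ * ε / (8 * A ^ 2) with hη
  have hη0 : 0 < η := by positivity
  obtain ⟨C, hC0, hC⟩ := exists_hartreePotential_le hV m hs hsN hγ hγs hη0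
  set d := θ * ε / (2 * (C + 1) * A) with hd
  have hd0 : 0 < d := by positivity
  refine ⟨√d, Real.sqrt_pos.2 hd0, fun u v hu hv huv => ?_⟩
  have hR : 0 ≤ R := (norm_nonneg u).trans hu
  have hL : ∀ w : EnergySpace hV m s, ‖w‖ ≤ R → ‖toL2 w‖ ^ 2 ≤ (T * R) ^ 2 := fun w hw => by
    have h : ‖toL2 w‖ ≤ T * R := (toL2L.le_opNorm w).trans (by gcongr)
    gcongr
  have hLA : ∀ w : EnergySpace hV m s, ‖w‖ ≤ R → ‖toL2 w‖ ^ 2 ≤ A := fun w hw => by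
    have h1 := hL w hw
    have : 0 ≤ R ^ 2 + (1 * R ^ 2 + C₁ * (T * R) ^ 2) := by positivity
    linarith
  have hHA : ∀ w : EnergySpace hV m s, ‖w‖ ≤ R → ∀ x, hartreePotential γ w x ≤ A := fun w hw x => by
    have h1 := hL w hw
    have h2 : 1 * ‖w‖ ^ 2 + C₁ * ‖toL2 w‖ ^ 2 ≤ 1 * R ^ 2 + C₁ * (T * R) ^ 2 := by gcongr
    have h3 := hC₁ w x
    have : 0 ≤ R ^ 2 + (T * R) ^ 2 := by positivity
    linarith
  have huv2 : ‖toL2 (u - v)‖ ^ 2 ≤ d := by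
    have := pow_le_pow_left₀ (norm_nonneg _) huv.le 2
    rwa [Real.sq_sqrt hd0.le] at this
  have huvR : ‖u - v‖ ^ 2 ≤ 4 * A := by
    have h1 : ‖u - v‖ ≤ R + R := (norm_sub_le u v).trans (add_le_add hu hv)
    have h2 := pow_le_pow_left₀ (norm_nonneg _) h1 2
    have : 0 ≤ (T * R) ^ 2 + (1 * R ^ 2 + C₁ * (T * R) ^ 2) := by positivity
    linarith
  have hb : ∀ x, hartreePotential γ (u - v) x ≤ η * (4 * A) + C * d := fun x =>
    (hC (u - v) x).trans (by gcongr)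
  have hmain := abs_hartreeEnergy_sub_le hs hsN hγ hγs u v hθ0 (hHA u hu) (hHA v hv) hb
  have hA0 : 0 < A := by linarith
  calc _ ≤ _ := hmain
    _ ≤ ((1 / (2 * θ)) * (η * (4 * A) + C * d) + θ * (A + A)) * A
        + A * ((1 / (2 * θ)) * d + θ * (A + A)) := by
        have h1 := hLA u hu
        have h2 := hLA v hv
        gcongr
    _ = 2 * η * A ^ 2 / θ + (C + 1) * d * A / (2 * θ) + 4 * θ * A ^ 2 := by
        field_simp
        ring
    _ = ε / 4 + ε / 4 + ε / 4 := by
        have e1 : 2 * η * A ^ 2 / θ = ε / 4 := by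
          rw [hη]; field_simp; norm_num
        have e2 : (C + 1) * d * A / (2 * θ) = ε / 4 := by
          rw [hd]; field_simp; norm_num
        have e3 : 4 * θ * A ^ 2 = ε / 4 := by
          rw [hθ]; field_simp; norm_num
        rw [e1, e2, e3]
    _ < ε := by linarith

theorem isSubcritical_hartreeEnergy (hV : IsConfining V) (m : ℝ) (hs : 0 < s) (hsN : 2 * s < N)
    (hγ : 0 < γ) (hγs : γ < 2 * s) :
    IsSubcritical (toL2L (hV := hV) (m := m) (s := s)) (hartreeEnergy γ) where
  nonneg := hartreeEnergy_nonneg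
  smul := hartreeEnergy_smul
  bound η hη := by
    obtain ⟨C, -, hC⟩ := exists_hartreePotential_le hV m hs hsN hγ hγs hη
    exact ⟨C, fun v => hartreeEnergy_le hs hsN hγ hγs v (hC v)⟩
  uniform R ε hε := hartreeEnergy_uniform hV m hs hsN hγ hγs R hε

theorem groundStates_eq_minimizers (hV : IsConfining V) (m s γ M : ℝ) :
    groundStates hV m s γ M = minimizers toL2L (hartreeEnergy γ) M := by
  ext v
  simp only [groundStates, minimizers, Set.mem_ofPred_eq, mass_eq]
  rfl

end OrbitalStability

end

/-! ### Orbital stability of the ground states. -/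

theorem theorem4p2 {N : ℕ} {V : FracHartree.Space N → ℝ} (hV : FracHartree.IsConfining V)
    {m s γ M : ℝ} (hm : 0 ≤ m) (hs : 0 < s) (hsN : s < (N : ℝ) / 2) (hγ : 0 < γ)
    (hγs : γ < 2 * s) (hM : 0 < M) (hwp : FracHartree.GloballyWellPosed hV m s γ) :
    ∀ ε : ℝ, 0 < ε → ∃ δ : ℝ, 0 < δ ∧
      ∀ (u₀ : FracHartree.EnergySpace hV m s) (u : ℝ → FracHartree.EnergySpace hV m s),
        FracHartree.IsSolution γ u₀ u →
        Metric.infEDist u₀ (FracHartree.groundStates hV m s γ M) < ENNReal.ofReal δ →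
        ∀ t : ℝ,
          Metric.infEDist (u t) (FracHartree.groundStates hV m s γ M) <
            ENNReal.ofReal ε := by
  intro ε hε
  obtain ⟨δ, hδ, h⟩ :=
    (OrbitalStability.isSubcritical_hartreeEnergy hV m hs (by linarith) hγ hγs).stable
      (OrbitalStability.exists_subseq_cauchySeq_toL2 hs) hM hε
  refine ⟨δ, hδ, fun u₀ u hu hlt t => ?_⟩
  obtain ⟨w, -, huniq, hcons⟩ := hwp u₀
  -- Well-posedness gives the conservation laws for its own solution `w`; uniqueness transfers them
  -- to `u`.
  rw [← huniq u hu] at hcons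
  obtain ⟨hmass, henergy⟩ := hcons t
  rw [OrbitalStability.groundStates_eq_minimizers] at hlt ⊢
  refine h u₀ (u t) hlt ?_ henergy
  rwa [OrbitalStability.mass_eq, OrbitalStability.mass_eq] at hmass
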